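/- Let $G$ be a connected (finite-dimensional, real) Lie group with Lie algebra $\mathfrak g$ and left Haar measure $dg$, let $h\in\mathfrak g$ be an Euler element, i.e. $(\operatorname{ad}h)^3=\operatorname{ad}h\neq 0$, and let $\tau_h$ be an involutive automorphism of $G$ whose differential is $e^{\pi i\operatorname{ad}h}$ (that is, $+1$ on $\ker\operatorname{ad}h$ and $-1$ on the $\pm1$-eigenspaces of $\operatorname{ad}h$). Put $G_{\tau_h}=G\rtimes_{\tau_h}\{\pm1\}$. Let $(U,\mathcal H)$ be an antiunitary representation of $G_{\tau_h}$ on a complex Hilbert space: a homomorphism into the group of unitary or antiunitary operators which restricts to a strongly continuous unitary representation of $G$ and for which $J:=U(e,-1)$ is antilinear. Inner products are antilinear in the first argument. Write $\mathcal H^\omega$ and $\mathcal H^\infty$ for the vectors $v$ whose orbit map $G\to\mathcal H$, $g\mapsto U(g)v$, is real analytic, respectively smooth. For $x\in\mathfrak g$ let $\mathtt dU(x)v=\frac{d}{dt}\big|_{t=0}U(\exp tx)v$; the space $\mathcal H^\infty$ carries the locally convex topology defined by the seminorms $v\mapsto\|\mathtt dU(x_1)\cdots\mathtt dU(x_k)v\|$,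 $k\ge 0$, $x_j\in\mathfrak g$, and $\mathcal H^{-\infty}$ is the space of continuous antilinear functionals on $\mathcal H^\infty$; $\mathcal H$ is embedded in it by $w\mapsto\langle\cdot,w\rangle$. Let $\mathcal H^\infty_{U_h}$ and $\mathcal H^{-\infty}_{U_h}$ be the corresponding spaces for the one-parameter group $U_h(t)=U(\exp th)$; restriction of functionals to $\mathcal H^\infty\subseteq\mathcal H^\infty_{U_h}$ maps $\mathcal H^{-\infty}_{U_h}$ to $\mathcal H^{-\infty}$. Let $\mathcal H^J_{\rm temp}$ be the set of all $v\in\mathcal H$ with $Jv=v$ for which $t\mapsto U_h(t)v$ extends to a holomorphic map $U_h^v\colon\{z\in\mathbb C:|\operatorname{Im}z|<\pi/2\}\to\mathcal H$ and both limits $$\beta^{\pm}(v)=\lim_{t\to\mp\pi/2}U_h^v(it)$$ exist in $\mathcal H^{-\infty}_{U_h}$ with respect to the weak-$*$ topology. For $\mathtt E\subseteq\mathcal H^{-\infty}$ and an open subset $\mathcal O\subseteq G$ let $$\mathsf H^G_{\mathtt E}(\mathcal O)=\overline{\operatorname{span}_{\mathbb R}\{U^{-\infty}(\varphi)\eta:\varphi\in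 C^\infty_c(\mathcal O,\mathbb R),\ \eta\in\mathtt E\}}\subseteq\mathcal H,\qquad (U^{-\infty}(\varphi)\eta)(\xi)=\int_G\varphi(g)\,\eta(U(g)^{-1}\xi)\,dg\quad(\xi\in\mathcal H^\infty).$$ **Theorem (Reeh–Schlieder property).** Let $\mathsf F\subseteq\mathcal H^J_{\rm temp}\cap\mathcal H^\omega$ be a real linear subspace such that $U(G)\mathsf F$ is total in $\mathcal H$ (its complex linear span is dense), and let $\mathtt E=\beta^+(\mathsf F)\subseteq\mathcal H^{-\infty}$. Then, for every nonempty open subset $\mathcal O\subseteq G$, the real subspace $\mathsf H^G_{\mathtt E}(\mathcal O)$ is total in $\mathcal H$. Hence the net $\mathsf H^G_{\mathtt E}$ satisfies * (Iso) $\mathsf H^G_{\mathtt E}(\mathcal O_1)\subseteq\mathsf H^G_{\mathtt E}(\mathcal O_2)$ for open subsets $\mathcal O_1\subseteq\mathcal O_2\subseteq G$; * (Cov) $U(g)\mathsf H^G_{\mathtt E}(\mathcal O)=\mathsf H^G_{\mathtt E}(g\mathcal O)$ for $g\in G$ and $\mathcal O\subseteq G$ open; * (RS) $\mathsf H^G_{\mathtt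 E}(\mathcal O)$ is cyclic, i.e. $\mathsf H^G_{\mathtt E}(\mathcal O)+i\,\mathsf H^G_{\mathtt E}(\mathcal O)$ is dense in $\mathcal H$, for every nonempty open subset $\mathcal O\subseteq G$. -/

import Mathlib

open scoped Manifold ContDiff Topology InnerProductSpace

noncomputable section

namespace LieNet

/-! ### Lie-theoretic data -/

section LieData

variable {E : Type*} [NormedAddCommGroup E] [NormedSpace ℝ E]
  {G : Type*} [TopologicalSpace G] [ChartedSpace E G] [Group G]

/-- `γ` is the smooth one-parameter subgroup `t ↦ exp (t x)`: a smooth homomorphism from the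
additive group `ℝ` to `G` whose derivative at `0` is `x`. -/
structure IsOneParameterSubgroup (x : GroupLieAlgebra 𝓘(ℝ, E) G) (γ : ℝ → G) : Prop where
  map_zero : γ 0 = 1
  map_add : ∀ s t : ℝ, γ (s + t) = γ s * γ t
  smooth : ContMDiff 𝓘(ℝ, ℝ) 𝓘(ℝ, E) ∞ γ
  deriv_zero : (mfderiv 𝓘(ℝ, ℝ) 𝓘(ℝ, E) γ 0 (1 : ℝ) : E) = x

open Classical in
/-- `expCurve x t = exp (t x)`, where `exp` is the exponential function of the Lie group `G`.
(In a finite-dimensional Lie group the one-parameter subgroup generated by `x` exists and is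
unique, so the second branch of the definition is never used there.) -/
def expCurve (x : GroupLieAlgebra 𝓘(ℝ, E) G) : ℝ → G :=
  if hx : ∃ γ : ℝ → G, IsOneParameterSubgroup x γ then hx.choose else fun _ => 1

theorem contMDiff_expCurve (x : GroupLieAlgebra 𝓘(ℝ, E) G) :
    ContMDiff 𝓘(ℝ, ℝ) 𝓘(ℝ, E) ∞ (expCurve x) := by
  unfold expCurve
  split_ifs with hx
  · exact hx.choose_spec.smooth
  · exact contMDiff_const

/-- An Euler element of the Lie algebra: `(ad h)³ = ad h ≠ 0`. -/
def IsEulerElement (h : GroupLieAlgebra 𝓘(ℝ, E) G) : Prop :=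
  (∀ x : GroupLieAlgebra 𝓘(ℝ, E) G, ⁅h, ⁅h, ⁅h, x⁆⁆⁆ = ⁅h, x⁆) ∧
    ∃ x : GroupLieAlgebra 𝓘(ℝ, E) G, ⁅h, x⁆ ≠ 0

/-- `τ` is an involutive Lie group automorphism integrating the Lie algebra involution
`exp (π i ad h)`, which acts as the identity on the `0`-eigenspace of `ad h` and as `-1` on the
`±1`-eigenspaces. -/
structure IsEulerInvolution (h : GroupLieAlgebra 𝓘(ℝ, E) G) (τ : G ≃* G) : Prop where
  involutive : ∀ g : G, τ (τ g) = g
  smooth : ContMDiff 𝓘(ℝ, E) 𝓘(ℝ, E) ∞ τ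
  deriv_zero : ∀ x : GroupLieAlgebra 𝓘(ℝ, E) G, ⁅h, x⁆ = 0 →
    (mfderiv 𝓘(ℝ, E) 𝓘(ℝ, E) τ 1 x : E) = x
  deriv_pos : ∀ x : GroupLieAlgebra 𝓘(ℝ, E) G, ⁅h, x⁆ = x →
    (mfderiv 𝓘(ℝ, E) 𝓘(ℝ, E) τ 1 x : E) = -x
  deriv_neg : ∀ x : GroupLieAlgebra 𝓘(ℝ, E) G, ⁅h, x⁆ = -x →
    (mfderiv 𝓘(ℝ, E) 𝓘(ℝ, E) τ 1 x : E) = -x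

/-- The action of `{±1}` on `G` in which `-1` acts by the involutive automorphism `τ`. -/
def signAction (τ : G ≃* G) (hτ : ∀ g : G, τ (τ g) = g) : ℤˣ →* MulAut G where
  toFun u := if u = 1 then 1 else τ
  map_one' := by simp
  map_mul' u v := by
    have hττ : (τ : MulAut G) * τ = 1 := by
      ext g
      exact hτ g
    rcases Int.units_eq_one_or u with rfl | rfl <;>
      rcases Int.units_eq_one_or v with rfl | rfl <;> simp [hττ]

/-- The group `G_τ = G ⋊ {±1}`. -/
abbrev ExtendedGroup (τ : G ≃* G) (hτ : ∀ g : G, τ (τ g) = g) : Type _ :=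
  G ⋊[signAction τ hτ] ℤˣ

end LieData

/-! ### Antiunitary representations -/

/-- The group `AU(𝓗)` of unitary or antiunitary operators: surjective isometries that are complex
linear or conjugate linear. -/
def antiunitaryGroup (𝓗 : Type*) [NormedAddCommGroup 𝓗] [InnerProductSpace ℂ 𝓗] :
    Subgroup (𝓗 ≃ₗᵢ[ℝ] 𝓗) where
  carrier := {T | (∀ (c : ℂ) (v : 𝓗), T (c • v) = c • T v) ∨
    (∀ (c : ℂ) (v : 𝓗), T (c • v) = (starRingEnd ℂ c) • T v)}
  one_mem' := Or.inl fun _ _ => rfl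
  mul_mem' := by
    rintro S T (hS | hS) (hT | hT)
    · exact Or.inl fun c v => by simp [hS, hT]
    · exact Or.inr fun c v => by simp [hS, hT]
    · exact Or.inr fun c v => by simp [hS, hT]
    · exact Or.inl fun c v => by simp [hS, hT]
  inv_mem' := by
    rintro S (hS | hS)
    · exact Or.inl fun c v => S.injective (by
        have hv : ∀ w, S (S⁻¹ w) = w := fun w => S.apply_symm_apply w
        rw [hS, hv, hv])
    · exact Or.inr fun c v => S.injective (by
        have hv : ∀ w, S (S⁻¹ w) = w := fun w => S.apply_symm_apply w
        rw [hS, hv, hv, Complex.conj_conj])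

section Rep

variable {E : Type*} [NormedAddCommGroup E] [NormedSpace ℝ E]
  {G : Type*} [TopologicalSpace G] [ChartedSpace E G] [Group G]
  {𝓗 : Type*} [NormedAddCommGroup 𝓗] [InnerProductSpace ℂ 𝓗]

/-- An antiunitary representation of `G_τ = G ⋊ {±1}`: a homomorphism into `AU(𝓗)` that restricts
to a strongly continuous unitary representation of `G` and maps `τ = (e, -1)` to an antilinear
(automatically involutive) isometry. -/
structure AntiunitaryRep (τ : G ≃* G) (hτ : ∀ g : G, τ (τ g) = g)
    (𝓗 : Type*) [NormedAddCommGroup 𝓗] [InnerProductSpace ℂ 𝓗] where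
  toHom : ExtendedGroup τ hτ →* antiunitaryGroup 𝓗
  map_smul : ∀ (g : G) (c : ℂ) (v : 𝓗),
    (toHom (SemidirectProduct.inl g)).1 (c • v) = c • (toHom (SemidirectProduct.inl g)).1 v
  continuous_orbit : ∀ v : 𝓗, Continuous fun g : G => (toHom (SemidirectProduct.inl g)).1 v
  conj_smul : ∀ (c : ℂ) (v : 𝓗),
    (toHom (SemidirectProduct.inr (-1))).1 (c • v) =
      (starRingEnd ℂ c) • (toHom (SemidirectProduct.inr (-1))).1 v

namespace AntiunitaryRep

variable {τ : G ≃* G} {hτ : ∀ g : G, τ (τ g) = g} (U : AntiunitaryRep τ hτ 𝓗)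

/-- The unitary operator `U(g)`, `g ∈ G`. -/
def op (g : G) : 𝓗 →L[ℂ] 𝓗 where
  toFun v := (U.toHom (SemidirectProduct.inl g)).1 v
  map_add' := by simp
  map_smul' := U.map_smul g
  cont := (U.toHom (SemidirectProduct.inl g)).1.continuous

/-- The conjugation `J = U(τ)`. -/
def J (v : 𝓗) : 𝓗 := (U.toHom (SemidirectProduct.inr (-1))).1 v

theorem op_mul (g₁ g₂ : G) (v : 𝓗) : U.op (g₁ * g₂) v = U.op g₁ (U.op g₂ v) := by
  simp [op]

/-! ### Analytic and smooth vectors of `G` -/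

variable (E) in
/-- Analytic vectors `𝓗^ω`: the orbit map `G → 𝓗` is real analytic. -/
def analyticVectors : Set 𝓗 :=
  {v | ContMDiff 𝓘(ℝ, E) 𝓘(ℝ, 𝓗) ω fun g : G => U.op g v}

variable (E) in
/-- Smooth vectors `𝓗^∞`: the orbit map `G → 𝓗` is smooth. -/
def smoothVectors : Submodule ℂ 𝓗 where
  carrier := {v | ContMDiff 𝓘(ℝ, E) 𝓘(ℝ, 𝓗) ∞ fun g : G => U.op g v}
  zero_mem' := by simpa using contMDiff_const
  add_mem' := by
    intro v w hv hw
    rw [Set.mem_ofPred_eq] at hv hw ⊢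
    simpa [Pi.add_def] using hv.add hw
  smul_mem' := by
    intro c v hv
    have hc := ((c • ContinuousLinearMap.id ℝ 𝓗).contMDiff (n := ∞)).comp hv
    simpa [Function.comp_def] using hc

/-- The derived representation `dU(x) v = d/dt|₀ U(exp (t x)) v`. -/
def dU (x : GroupLieAlgebra 𝓘(ℝ, E) G) (v : 𝓗) : 𝓗 :=
  deriv (fun t : ℝ => U.op (expCurve x t) v) 0

/-- `dU(x₁) ⋯ dU(x_k) v` for the list `[x₁, …, x_k]`. -/
def dUList (l : List (GroupLieAlgebra 𝓘(ℝ, E) G)) (v : 𝓗) : 𝓗 :=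
  l.foldr U.dU v

variable (E) in
/-- The topology of `𝓗^∞`: the coarsest one for which all the maps
`v ↦ dU(x₁) ⋯ dU(x_k) v` into `𝓗` are continuous. These maps are linear, so it is the locally
convex topology of the seminorms `v ↦ ‖dU(x) v‖`, `x` in the enveloping algebra. -/
@[reducible]
def smoothTopology : TopologicalSpace (U.smoothVectors E) :=
  TopologicalSpace.induced
    (fun v (l : List (GroupLieAlgebra 𝓘(ℝ, E) G)) => U.dUList l (v : 𝓗)) inferInstance

variable (E) in
/-- Distribution vectors `𝓗^{-∞}`: continuous antilinear functionals on `𝓗^∞`. -/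
def distributionVectors : Submodule ℂ (U.smoothVectors E →ₛₗ[starRingEnd ℂ] ℂ) where
  carrier := {η | Continuous[U.smoothTopology E, inferInstance] η}
  zero_mem' := by
    let _ := U.smoothTopology E
    exact continuous_const
  add_mem' := by
    let _ := U.smoothTopology E
    intro η ζ hη hζ
    exact Continuous.add hη hζ
  smul_mem' := by
    let _ := U.smoothTopology E
    intro c η hη
    exact Continuous.const_smul (M := ℂ) hη c

/-! ### Smooth vectors and distribution vectors of the one-parameter group `U_h` -/

/-- Smooth vectors `𝓗^∞_{U_h}` of the one-parameter group `U_h(t) = U(exp (t h))`. -/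
def oneParamSmoothVectors (h : GroupLieAlgebra 𝓘(ℝ, E) G) : Submodule ℂ 𝓗 where
  carrier := {v | ContDiff ℝ ∞ fun t : ℝ => U.op (expCurve h t) v}
  zero_mem' := by simpa using contDiff_const
  add_mem' := by
    intro v w hv hw
    rw [Set.mem_ofPred_eq] at hv hw ⊢
    simpa [Pi.add_def] using hv.add hw
  smul_mem' := by
    intro c v hv
    rw [Set.mem_ofPred_eq] at hv ⊢
    simpa [Pi.smul_def] using hv.const_smul c

/-- The topology of `𝓗^∞_{U_h}`, defined by the maps `v ↦ dU(h)^n v`, `n ∈ ℕ`. -/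
@[reducible]
def oneParamSmoothTopology (h : GroupLieAlgebra 𝓘(ℝ, E) G) :
    TopologicalSpace (U.oneParamSmoothVectors h) :=
  TopologicalSpace.induced (fun v (n : ℕ) => (U.dU h)^[n] (v : 𝓗)) inferInstance

/-- Distribution vectors `𝓗^{-∞}_{U_h}` of the one-parameter group `U_h`. -/
def oneParamDistributionVectors (h : GroupLieAlgebra 𝓘(ℝ, E) G) :
    Submodule ℂ (U.oneParamSmoothVectors h →ₛₗ[starRingEnd ℂ] ℂ) where
  carrier := {η | Continuous[U.oneParamSmoothTopology h, inferInstance] η}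
  zero_mem' := by
    let _ := U.oneParamSmoothTopology h
    exact continuous_const
  add_mem' := by
    let _ := U.oneParamSmoothTopology h
    intro η ζ hη hζ
    exact Continuous.add hη hζ
  smul_mem' := by
    let _ := U.oneParamSmoothTopology h
    intro c η hη
    exact Continuous.const_smul (M := ℂ) hη c

/-- `𝓗^∞ ⊆ 𝓗^∞_{U_h}`. -/
theorem smoothVectors_le (h : GroupLieAlgebra 𝓘(ℝ, E) G) :
    U.smoothVectors E ≤ U.oneParamSmoothVectors h := by
  intro v hv
  have hc := ContMDiff.comp (I := 𝓘(ℝ, ℝ)) (I' := 𝓘(ℝ, E)) (I'' := 𝓘(ℝ, 𝓗)) (n := ∞)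
    (g := fun g : G => U.op g v) hv (contMDiff_expCurve h)
  exact hc.contDiff

theorem continuous_smoothInclusion (h : GroupLieAlgebra 𝓘(ℝ, E) G) :
    Continuous[U.smoothTopology E, U.oneParamSmoothTopology h]
      (Submodule.inclusion (U.smoothVectors_le h)) := by
  let _ := U.smoothTopology E
  let _ := U.oneParamSmoothTopology h
  refine continuous_induced_rng.2 (continuous_pi fun n => ?_)
  have hn : ∀ v : 𝓗, (U.dU h)^[n] v = U.dUList (List.replicate n h) v := by
    intro v
    induction n with
    | zero => rfl
    | succ n ih => rw [Function.iterate_succ_apply', ih]; rfl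
  have hc : Continuous fun v : U.smoothVectors E => U.dUList (List.replicate n h) (v : 𝓗) :=
    (continuous_apply (List.replicate n h)).comp continuous_induced_dom
  refine hc.congr fun v => ?_
  exact (hn v).symm

/-- The inclusion `𝓗^{-∞}_{U_h} → 𝓗^{-∞}`, restriction of functionals to `𝓗^∞`. -/
def distributionInclusion (h : GroupLieAlgebra 𝓘(ℝ, E) G) (η : U.oneParamDistributionVectors h) :
    U.distributionVectors E :=
  ⟨η.1.comp (Submodule.inclusion (U.smoothVectors_le h)), by
    let _ := U.smoothTopology E
    let _ := U.oneParamSmoothTopology h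
    have hη : Continuous η.1 := η.2
    exact hη.comp (U.continuous_smoothInclusion h)⟩

/-! ### Boundary values -/

/-- The strip `|Im z| < π / 2`. -/
def strip : Set ℂ := {z | |z.im| < Real.pi / 2}

/-- `f` restricts on the strip to the holomorphic extension of the orbit map
`t ↦ U(exp (t h)) v`. -/
def IsOrbitExtension (h : GroupLieAlgebra 𝓘(ℝ, E) G) (v : 𝓗) (f : ℂ → 𝓗) : Prop :=
  DifferentiableOn ℂ f strip ∧ ∀ t : ℝ, f (t : ℂ) = U.op (expCurve h t) v

/-- `η = β⁺(v)`: the weak-* limit of the extended orbit map `U_h^v(i t)` in `𝓗^{-∞}_{U_h}` for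
`t → -π/2` exists and is `η`. -/
def IsBetaPlus (h : GroupLieAlgebra 𝓘(ℝ, E) G) (v : 𝓗)
    (η : U.oneParamDistributionVectors h) : Prop :=
  ∃ f : ℂ → 𝓗, U.IsOrbitExtension h v f ∧ ∀ ξ : U.oneParamSmoothVectors h,
    Filter.Tendsto (fun t : ℝ => ⟪(ξ : 𝓗), f (t * Complex.I)⟫_ℂ)
      (𝓝[>] (-(Real.pi / 2))) (𝓝 (η.1 ξ))

/-- `η = β⁻(v)`: the analogous weak-* limit for `t → π/2`. -/
def IsBetaMinus (h : GroupLieAlgebra 𝓘(ℝ, E) G) (v : 𝓗)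
    (η : U.oneParamDistributionVectors h) : Prop :=
  ∃ f : ℂ → 𝓗, U.IsOrbitExtension h v f ∧ ∀ ξ : U.oneParamSmoothVectors h,
    Filter.Tendsto (fun t : ℝ => ⟪(ξ : 𝓗), f (t * Complex.I)⟫_ℂ)
      (𝓝[<] (Real.pi / 2)) (𝓝 (η.1 ξ))

/-- Tempered vectors `𝓗^J_temp`: the `J`-fixed vectors for which the orbit map of `U_h` extends
holomorphically to the strip and both boundary values exist in `𝓗^{-∞}_{U_h}`. -/
def temperedVectors (h : GroupLieAlgebra 𝓘(ℝ, E) G) : Set 𝓗 :=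
  {v | U.J v = v ∧ (∃ f : ℂ → 𝓗, U.IsOrbitExtension h v f) ∧
    (∃ η, U.IsBetaPlus h v η) ∧ ∃ η, U.IsBetaMinus h v η}

open Classical in
/-- The boundary value `β⁺(v)`, considered for `v` in `𝓗^J_temp`. -/
def betaPlus (h : GroupLieAlgebra 𝓘(ℝ, E) G) (v : 𝓗) : U.oneParamDistributionVectors h :=
  if hv : ∃ η, U.IsBetaPlus h v η then hv.choose else 0

/-- `β⁺(F)` as a subset of `𝓗^{-∞}`. -/
def betaPlusImage (h : GroupLieAlgebra 𝓘(ℝ, E) G) (F : Submodule ℝ 𝓗) :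
    Set (U.distributionVectors E) :=
  (fun v => U.distributionInclusion h (U.betaPlus h v)) '' (F : Set 𝓗)

/-! ### The net of real subspaces -/

variable (E) in
/-- `𝓗^∞` is invariant under `U(G)`. -/
theorem op_mem_smoothVectors [LieGroup 𝓘(ℝ, E) ω G] (g₀ : G) {v : 𝓗}
    (hv : v ∈ U.smoothVectors E) : U.op g₀ v ∈ U.smoothVectors E := by
  have hc := ContMDiff.comp (I := 𝓘(ℝ, E)) (I' := 𝓘(ℝ, E)) (I'' := 𝓘(ℝ, 𝓗)) (n := ∞)
    (g := fun g : G => U.op g v) hv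
    (contMDiff_mul_right (I := 𝓘(ℝ, E)) (n := ∞) (a := g₀))
  change ContMDiff 𝓘(ℝ, E) 𝓘(ℝ, 𝓗) ∞ fun g : G => U.op g (U.op g₀ v)
  simpa [Function.comp_def, op_mul] using hc

variable (E) in
/-- The operator `U^∞(g)` on `𝓗^∞`. -/
def opSmooth [LieGroup 𝓘(ℝ, E) ω G] (g : G) : U.smoothVectors E →ₗ[ℂ] U.smoothVectors E :=
  (U.op g).toLinearMap.restrict fun _ hv => U.op_mem_smoothVectors E g hv

/-- The functional `U^{-∞}(φ) η = ∫ φ(g) U^{-∞}(g) η dg` on `𝓗^∞`, where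
`(U^{-∞}(g) η)(ξ) = η(U(g)⁻¹ ξ)`. -/
def integrated [LieGroup 𝓘(ℝ, E) ω G] [MeasurableSpace G] (μ : MeasureTheory.Measure G)
    (φ : G → ℝ) (η : U.distributionVectors E) (ξ : U.smoothVectors E) : ℂ :=
  ∫ g, (φ g : ℂ) * η.1 (U.opSmooth E g⁻¹ ξ) ∂μ

/-- The vectors of `𝓗` of the form `U^{-∞}(φ) η` with `φ ∈ C_c^∞(O, ℝ)` and `η ∈ D`, where
`w ∈ 𝓗` is identified with the distribution vector `⟨·, w⟩`. -/
def netGenerators [LieGroup 𝓘(ℝ, E) ω G] [MeasurableSpace G] (μ : MeasureTheory.Measure G)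
    (D : Set (U.distributionVectors E)) (O : Set G) : Set 𝓗 :=
  {w | ∃ φ : G → ℝ, ContMDiff 𝓘(ℝ, E) 𝓘(ℝ, ℝ) ∞ φ ∧ HasCompactSupport φ ∧ tsupport φ ⊆ O ∧
    ∃ η ∈ D, ∀ ξ : U.smoothVectors E, ⟪(ξ : 𝓗), w⟫_ℂ = U.integrated μ φ η ξ}

/-- The closed real subspace `H_D^G(O)`: the closed real span of `U^{-∞}(C_c^∞(O, ℝ)) D`. -/
def net [LieGroup 𝓘(ℝ, E) ω G] [MeasurableSpace G] (μ : MeasureTheory.Measure G)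
    (D : Set (U.distributionVectors E)) (O : Set G) : Submodule ℝ 𝓗 :=
  (Submodule.span ℝ (U.netGenerators μ D O)).topologicalClosure

end AntiunitaryRep

/-- A subset of `𝓗` is total if its complex linear span is dense. -/
def IsTotal (S : Set 𝓗) : Prop :=
  Dense (Submodule.span ℂ S : Set 𝓗)

/-- A real subspace `V` is cyclic if `V + i V` is dense. -/
def IsCyclic (V : Submodule ℝ 𝓗) : Prop :=
  Dense {z : 𝓗 | ∃ v ∈ V, ∃ w ∈ V, z = v + Complex.I • w}

/-- Isotony of a family of real subspaces indexed by the open subsets of `G`. -/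
def Isotone (N : Set G → Submodule ℝ 𝓗) : Prop :=
  ∀ O₁ O₂ : Set G, IsOpen O₁ → IsOpen O₂ → O₁ ⊆ O₂ → N O₁ ≤ N O₂

/-- Covariance: `U(g) N(O) = N(g O)`. -/
def Covariant {τ : G ≃* G} {hτ : ∀ g : G, τ (τ g) = g} (U : AntiunitaryRep τ hτ 𝓗)
    (N : Set G → Submodule ℝ 𝓗) : Prop :=
  ∀ (g : G) (O : Set G), IsOpen O →
    U.op g '' (N O : Set 𝓗) = (N ((fun x => g * x) '' O) : Set 𝓗)

/-- The Reeh–Schlieder property: `N(O)` is cyclic for every nonempty open `O`. -/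
def ReehSchlieder (N : Set G → Submodule ℝ 𝓗) : Prop :=
  ∀ O : Set G, IsOpen O → O.Nonempty → IsCyclic (N O)

end Rep

end LieNet

end

/-! Let w be orthogonal to the net over O. Since U(G)F is total, it suffices that ⟨w, U(g)v⟩ = 0 for
all g ∈ G and v ∈ F. As v is an analytic vector and G is connected, this is only needed for g ∈ O
(`eq_zero_of_contMDiff_omega`). Testing against φ ∈ C_c^∞(O, ℝ) reduces it to ⟨U(φ)*w, v⟩ = 0, where
U(φ)*w = ∫ φ(g) U(g)⁻¹w dg is `smear` (`inner_op_eq_zero`). Orthogonality to the net gives the same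
vanishing with the boundary value in place of v: β⁺(v) kills every U(φ)*w.

The bridge is p(z) = ⟨U(φ)*w, U_h^v(z)⟩, holomorphic on the strip, with p(0) the number in question.
Its vertical limit at s - iπ/2 is β⁺(v) evaluated at U_h(-s)U(φ)*w. This vector is U(ψ)*w for a
right translate ψ of φ, rescaled by the modular function, and supp ψ ⊆ O for small s. So p has
vertical limit 0 along an interval of the lower boundary line and vanishes (`inner_smear_eq_zero`).

Two points need care. The limits on the boundary are only pointwise:
`eq_zero_of_tendsto_zero_boundary` gets a uniform bound from Baire, L¹-smallness from dominated
convergence, and concludes with the maximum principle. Moreover w is an arbitrary vector, whereas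
distribution vectors act on smooth ones. But β⁺(v) has finite order (`exists_jet_functional`), and
the derivatives dU(h)^k of U(φ)*ξ fall on φ, so ξ ↦ β⁺(v)(U(φ)*ξ) is bounded on all of 𝓗. Riesz then
yields a vector (`exists_smeared_vector`), which `integrated_eq` identifies with U^{-∞}(φ)β⁺(v). -/

noncomputable section

namespace LieNet

open MeasureTheory Filter Set
open scoped Pointwise

universe u

set_option linter.unusedSectionVars false

/-! ### Boundary uniqueness for holomorphic functions on a strip. -/

section ComplexBoundary

/-- A continuous function on the closed square of half-side `d` around `z₀`, holomorphic inside
and small on the bottom side, is small at the centre. -/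
theorem norm_pow_four_le_of_square {q : ℂ → ℂ} {z₀ : ℂ} {d M m : ℝ} (hd : 0 < d)
    (hm : 0 ≤ m)
    (hq : ∀ z : ℂ, |(z - z₀).re| ≤ d → |(z - z₀).im| ≤ d → DifferentiableAt ℂ q z)
    (hM : ∀ z : ℂ, |(z - z₀).re| ≤ d → |(z - z₀).im| ≤ d → ‖q z‖ ≤ M)
    (hbot : ∀ z : ℂ, |(z - z₀).re| ≤ d → (z - z₀).im = -d → ‖q z‖ ≤ m) :
    ‖q z₀‖ ^ 4 ≤ m * M ^ 3 := by
  have hM0 : 0 ≤ M := (norm_nonneg _).trans (hM z₀ (by simp [hd.le]) (by simp [hd.le]))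
  let K : Set ℂ := {z | |(z - z₀).re| < d ∧ |(z - z₀).im| < d}
  -- Product over the four quarter turns about z₀. For z on the boundary of the square one of the
  -- four arguments lies on the bottom side, so the maximum principle bounds Q by m * M ^ 3, while Q
  -- z₀ = q z₀ ^ 4.
  let Q : ℂ → ℂ := fun z => q z * q (z₀ + Complex.I * (z - z₀)) *
    q (z₀ - (z - z₀)) * q (z₀ - Complex.I * (z - z₀))
  have hcl : closure K ⊆ {z | |(z - z₀).re| ≤ d ∧ |(z - z₀).im| ≤ d} := by
    apply closure_minimal
    · exact fun z hz => ⟨hz.1.le, hz.2.le⟩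
    · exact (isClosed_le (f := fun z : ℂ => |(z - z₀).re|) (by fun_prop) continuous_const).inter
        (isClosed_le (f := fun z : ℂ => |(z - z₀).im|) (by fun_prop) continuous_const)
  have hKo : IsOpen K := (isOpen_lt (f := fun z : ℂ => |(z - z₀).re|) (by fun_prop) continuous_const).inter
        (isOpen_lt (f := fun z : ℂ => |(z - z₀).im|) (by fun_prop) continuous_const)
  have hfr : ∀ z ∈ frontier K, |(z - z₀).re| ≤ d ∧ |(z - z₀).im| ≤ d ∧
      (|(z - z₀).re| = d ∨ |(z - z₀).im| = d) := by
    intro z hz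
    rw [hKo.frontier_eq] at hz
    obtain ⟨h1, h2⟩ := hcl hz.1
    refine ⟨h1, h2, ?_⟩
    by_contra! hne
    exact hz.2 ⟨lt_of_le_of_ne h1 hne.1, lt_of_le_of_ne h2 hne.2⟩
  have hbd : Bornology.IsBounded K := by
    refine (Metric.isBounded_closedBall (x := z₀) (r := d + d)).subset fun z hz => ?_
    rw [Metric.mem_closedBall, dist_eq_norm]
    exact (Complex.norm_le_abs_re_add_abs_im _).trans (add_le_add hz.1.le hz.2.le)
  have hsq : ∀ z : ℂ, |(z - z₀).re| ≤ d → |(z - z₀).im| ≤ d → DifferentiableAt ℂ Q z := by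
    intro z h1 h2
    refine DifferentiableAt.mul (DifferentiableAt.mul (DifferentiableAt.mul (hq z h1 h2) ?_) ?_) ?_
    · refine DifferentiableAt.comp z (hq _ ?_ ?_) (by fun_prop)
      · simpa [abs_sub_comm] using h2
      · simpa using h1
    · refine DifferentiableAt.comp z (hq _ ?_ ?_) (by fun_prop)
      · simpa [abs_sub_comm] using h1
      · simpa [abs_sub_comm] using h2
    · refine DifferentiableAt.comp z (hq _ ?_ ?_) (by fun_prop)
      · simpa using h2
      · simpa [abs_sub_comm] using h1
  have hmax : ‖Q z₀‖ ≤ m * M ^ 3 := by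
    refine Complex.norm_le_of_forall_mem_frontier_norm_le (U := K) hbd
      (DifferentiableOn.diffContOnCl fun z hz =>
        (hsq z (hcl hz).1 (hcl hz).2).differentiableWithinAt) ?_
      (subset_closure (show z₀ ∈ K by simp [K, hd]))
    intro z hz
    obtain ⟨h1, h2, h3⟩ := hfr z hz
    have e1 := hM z h1 h2
    have e2 : ‖q (z₀ + Complex.I * (z - z₀))‖ ≤ M :=
      hM _ (by simpa [abs_sub_comm] using h2) (by simpa using h1)
    have e3 : ‖q (z₀ - (z - z₀))‖ ≤ M :=
      hM _ (by simpa [abs_sub_comm] using h1) (by simpa [abs_sub_comm] using h2)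
    have e4 : ‖q (z₀ - Complex.I * (z - z₀))‖ ≤ M :=
      hM _ (by simpa using h2) (by simpa [abs_sub_comm] using h1)
    have hprod : ∀ {a b c e : ℝ}, 0 ≤ a → 0 ≤ b → 0 ≤ c → 0 ≤ e → a ≤ m → b ≤ M → c ≤ M → e ≤ M →
        a * b * c * e ≤ m * M ^ 3 := by
      intro a b c e _ _ _ _ h1 h2 h3 h4
      calc a * b * c * e ≤ m * M * M * M := by gcongr
        _ = m * M ^ 3 := by ring
    simp only [Q, norm_mul]
    rcases h3 with h3 | h3
    · rcases abs_choice (z - z₀).re with h | h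
      · have e := hbot (z₀ - Complex.I * (z - z₀)) (by simpa using h2) (by
          rw [← h3, h]; simp)
        calc _ = ‖q (z₀ - Complex.I * (z - z₀))‖ * ‖q z‖ * ‖q (z₀ + Complex.I * (z - z₀))‖ *
            ‖q (z₀ - (z - z₀))‖ := by ring
          _ ≤ _ := by apply hprod <;> first | positivity | assumption
      · have e := hbot (z₀ + Complex.I * (z - z₀)) (by simpa [abs_sub_comm] using h2) (by
          rw [← h3, h]; simp)
        calc _ = ‖q (z₀ + Complex.I * (z - z₀))‖ * ‖q z‖ * ‖q (z₀ - (z - z₀))‖ *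
            ‖q (z₀ - Complex.I * (z - z₀))‖ := by ring
          _ ≤ _ := by apply hprod <;> first | positivity | assumption
    · rcases abs_choice (z - z₀).im with h | h
      · have e := hbot (z₀ - (z - z₀)) (by simpa [abs_sub_comm] using h1) (by
          rw [← h3, h]; simp)
        calc _ = ‖q (z₀ - (z - z₀))‖ * ‖q z‖ * ‖q (z₀ + Complex.I * (z - z₀))‖ *
            ‖q (z₀ - Complex.I * (z - z₀))‖ := by ring
          _ ≤ _ := by apply hprod <;> first | positivity | assumption
      · have e := hbot z h1 (by rw [← h3, h]; simp)
        apply hprod <;> first | positivity | assumption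
  calc ‖q z₀‖ ^ 4 = ‖Q z₀‖ := by simp [Q]; ring
    _ ≤ _ := hmax


theorem strip_slice_continuousOn {a b : ℝ} {p : ℂ → ℂ}
    (hp : DifferentiableOn ℂ p {z | a < z.im ∧ z.im < b}) (s : ℝ) :
    ContinuousOn (fun t : ℝ => p (s + t * Complex.I)) (Ioo a b) :=
  hp.continuousOn.comp (by fun_prop) fun t ht => by simpa using ht

/-- A holomorphic function on a strip whose vertical boundary limits exist on an interval is
bounded near some smaller interval. -/
theorem exists_bound_near_boundary {a b c : ℝ} (hcb : c < b) {p : ℂ → ℂ}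
    (hp : DifferentiableOn ℂ p {z | a < z.im ∧ z.im < b}) {s₀ s₁ : ℝ} (hs : s₀ < s₁)
    (hlim : ∀ s ∈ Ioo s₀ s₁,
      Tendsto (fun t : ℝ => p (s + t * Complex.I)) (𝓝[>] a) (𝓝 0)) :
    ∃ s₂ s₃ : ℝ, s₂ < s₃ ∧ Icc s₂ s₃ ⊆ Ioo s₀ s₁ ∧ ∃ M : ℝ, ∀ s ∈ Icc s₂ s₃, ∀ t ∈ Ioc a c,
      ‖p (s + t * Complex.I)‖ ≤ M := by
  -- Baire category: these closed sets cover the interval, since each vertical slice is bounded,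
  -- near `a` by its limit and above by compactness. Adjoining the complement of the interval makes
  -- them cover ℝ.
  let A : ℕ → Set ℝ := fun n => {s | ∀ t ∈ Ioc a c, ‖p (s + t * Complex.I)‖ ≤ n}
  have hAc : ∀ n, IsClosed (A n) := by
    intro n
    have : A n = ⋂ t ∈ Ioc a c, {s : ℝ | ‖p (s + t * Complex.I)‖ ≤ n} := by
      ext s; simp [A]
    rw [this]
    refine isClosed_biInter fun t ht => isClosed_le ?_ continuous_const
    refine (hp.continuousOn.comp_continuous (by fun_prop) fun s => ?_).norm
    simpa using ⟨ht.1, ht.2.trans_lt hcb⟩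
  have hun : ⋃ n, (A n ∪ (Ioo s₀ s₁)ᶜ) = univ := by
    refine eq_univ_of_forall fun s => ?_
    by_cases hsI : s ∈ Ioo s₀ s₁
    swap
    · exact mem_iUnion.2 ⟨0, Or.inr hsI⟩
    have h1 : ∀ᶠ t : ℝ in 𝓝[>] a, ‖p (s + t * Complex.I)‖ ≤ 1 :=
      (hlim s hsI).norm.eventually_le_const (by simp)
    obtain ⟨u, hu, hu'⟩ := (mem_nhdsGT_iff_exists_Ioo_subset).1 h1
    have hcomp : IsCompact ((fun t : ℝ => p (s + t * Complex.I)) '' Icc u c) :=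
      isCompact_Icc.image_of_continuousOn
        ((strip_slice_continuousOn hp s).mono fun t ht =>
          ⟨(mem_Ioi.1 hu).trans_le ht.1, ht.2.trans_lt hcb⟩)
    obtain ⟨C, hC⟩ := hcomp.isBounded.exists_norm_le
    obtain ⟨n, hn⟩ := exists_nat_ge (max 1 C)
    refine mem_iUnion.2 ⟨n, Or.inl fun t ht => ?_⟩
    rcases lt_or_ge t u with htu | htu
    · have h2 : ‖p (s + t * Complex.I)‖ ≤ 1 := hu' ⟨ht.1, htu⟩
      exact h2.trans ((le_max_left _ _).trans hn)
    · exact (hC _ ⟨t, ⟨htu, ht.2⟩, rfl⟩).trans ((le_max_right _ _).trans hn)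
  have hd := dense_iUnion_interior_of_closed
    (fun n => (hAc n).union (isOpen_Ioo (a := s₀) (b := s₁)).isClosed_compl) hun
  obtain ⟨s, hsI, hsA⟩ := hd.inter_open_nonempty (Ioo s₀ s₁) isOpen_Ioo (nonempty_Ioo.2 hs)
  obtain ⟨n, hn⟩ := mem_iUnion.1 hsA
  have hnhds : Ioo s₀ s₁ ∩ A n ∈ 𝓝 s := by
    filter_upwards [isOpen_Ioo.mem_nhds hsI, mem_interior_iff_mem_nhds.1 hn] with x hx hx'
    exact ⟨hx, hx'.resolve_right (not_not.2 hx)⟩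
  obtain ⟨ε, hε, hsub⟩ := Metric.nhds_basis_closedBall.mem_iff.1 hnhds
  rw [Real.closedBall_eq_Icc] at hsub
  exact ⟨s - ε, s + ε, by linarith, fun x hx => (hsub hx).1, n, fun x hx => (hsub hx).2⟩

/-- Horizontal averaging preserves holomorphy: a compact thickening of the segment supplies the
bound on the derivative. Averages are used because their sup norm on a horizontal line is controlled
by an L¹ norm of p. -/
theorem differentiableAt_integral_translate {U : Set ℂ} (hU : IsOpen U) {p : ℂ → ℂ}
    (hp : DifferentiableOn ℂ p U) {ε : ℝ} {z₀ : ℂ} (hz₀ : ∀ s ∈ uIcc 0 ε, z₀ + (s : ℂ) ∈ U) :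
    DifferentiableAt ℂ (fun z => ∫ s in (0 : ℝ)..ε, p (z + s)) z₀ := by
  let K : Set ℂ := (fun s : ℝ => z₀ + (s : ℂ)) '' uIcc 0 ε
  have hK : IsCompact K := isCompact_uIcc.image (by fun_prop)
  have hKU : K ⊆ U := by rintro _ ⟨s, hs, rfl⟩; exact hz₀ s hs
  obtain ⟨r, hr, hrU⟩ := hK.exists_cthickening_subset_open hU hKU
  have hK' : IsCompact (Metric.cthickening r K) := hK.cthickening
  have hd : DifferentiableOn ℂ (deriv p) U := hp.deriv hU
  obtain ⟨C, hC⟩ := (hK'.image_of_continuousOn (hd.continuousOn.mono hrU)).isBounded.exists_norm_le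
  have hmem : ∀ z ∈ Metric.ball z₀ r, ∀ s ∈ uIcc 0 ε, z + (s : ℂ) ∈ Metric.cthickening r K := by
    intro z hz s hs
    refine Metric.mem_cthickening_of_dist_le _ (z₀ + s) _ _ ⟨s, hs, rfl⟩ ?_
    simpa using (Metric.mem_ball.1 hz).le
  have hcont : ∀ {f : ℂ → ℂ}, ContinuousOn f U → ∀ z ∈ Metric.ball z₀ r,
      ContinuousOn (fun s : ℝ => f (z + s)) (uIcc 0 ε) := fun hf z hz =>
    hf.comp (by fun_prop) fun s hs => hrU (hmem z hz s hs)
  have key := intervalIntegral.hasDerivAt_integral_of_dominated_loc_of_deriv_le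
    (F := fun (z : ℂ) (s : ℝ) => p (z + s)) (F' := fun (z : ℂ) (s : ℝ) => deriv p (z + s))
    (μ := volume) (a := 0) (b := ε) (bound := fun _ => C) (s := Metric.ball z₀ r) (x₀ := z₀)
    (Metric.ball_mem_nhds _ hr) ?_ ?_ ?_ ?_ ?_ ?_
  · exact key.2.differentiableAt
  · filter_upwards [Metric.ball_mem_nhds z₀ hr] with z hz
    exact ((hcont hp.continuousOn z hz).mono uIoc_subset_uIcc).aestronglyMeasurable
      measurableSet_uIoc
  · exact (hcont hp.continuousOn z₀ (Metric.mem_ball_self hr)).intervalIntegrable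
  · exact ((hcont hd.continuousOn z₀ (Metric.mem_ball_self hr)).mono
      uIoc_subset_uIcc).aestronglyMeasurable measurableSet_uIoc
  · exact Eventually.of_forall fun s hs z hz => hC _ ⟨_, hmem z hz s (uIoc_subset_uIcc hs), rfl⟩
  · exact intervalIntegrable_const
  · refine Eventually.of_forall fun s hs z hz => ?_
    have := (hp.differentiableAt (hU.mem_nhds
      (hrU (hmem z hz s (uIoc_subset_uIcc hs))))).hasDerivAt
    exact this.comp_add_const z (s : ℂ)

theorem isOpen_strip (a b : ℝ) : IsOpen {z : ℂ | a < z.im ∧ z.im < b} :=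
  (isOpen_lt continuous_const Complex.continuous_im).inter
    (isOpen_lt Complex.continuous_im continuous_const)

/-- Uniqueness: a holomorphic function on a strip which has vertical limit `0` at all points of an
interval of the lower boundary line vanishes. -/
theorem eq_zero_of_tendsto_zero_boundary {a b : ℝ} (hab : a < b) {p : ℂ → ℂ}
    (hp : DifferentiableOn ℂ p {z | a < z.im ∧ z.im < b}) {s₀ s₁ : ℝ} (hs : s₀ < s₁)
    (hlim : ∀ s ∈ Ioo s₀ s₁,
      Tendsto (fun t : ℝ => p (s + t * Complex.I)) (𝓝[>] a) (𝓝 0)) :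
    EqOn p 0 {z | a < z.im ∧ z.im < b} := by
  obtain ⟨c, hac, hcb⟩ := exists_between hab
  obtain ⟨s₂, s₃, h23, hsub, M, hM⟩ := exists_bound_near_boundary hcb hp hs hlim
  have hU := isOpen_strip a b
  -- Pointwise limits give no uniform smallness of p near the boundary, but with the bound M they
  -- give L¹-smallness by dominated convergence.
  let m : ℝ → ℝ := fun t => ∫ s in s₂..s₃, ‖p (s + t * Complex.I)‖
  have hM0 : 0 ≤ M := (norm_nonneg _).trans (hM s₂ ⟨le_rfl, h23.le⟩ c ⟨hac, le_rfl⟩)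
  have hslice : ∀ t ∈ Ioc a c, Continuous fun s : ℝ => p (s + t * Complex.I) := fun t ht =>
    hp.continuousOn.comp_continuous (by fun_prop) fun s => by
      simpa using ⟨ht.1, ht.2.trans_lt hcb⟩
  have hev : ∀ᶠ t in 𝓝[>] a, t ∈ Ioc a c := Ioc_mem_nhdsGT hac
  have hm : Tendsto m (𝓝[>] a) (𝓝 0) := by
    have := intervalIntegral.tendsto_integral_filter_of_dominated_convergence
      (μ := volume) (a := s₂) (b := s₃) (l := 𝓝[>] a)
      (F := fun (t : ℝ) (s : ℝ) => ‖p (s + t * Complex.I)‖) (f := fun _ => (0 : ℝ))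
      (fun _ => M) ?_ ?_ intervalIntegrable_const ?_
    · simpa using this
    · filter_upwards [hev] with t ht
      exact (hslice t ht).norm.aestronglyMeasurable
    · filter_upwards [hev] with t ht
      refine Eventually.of_forall fun s hs => ?_
      rw [uIoc_of_le h23.le] at hs
      simpa using hM s ⟨hs.1.le, hs.2⟩ t ht
    · refine Eventually.of_forall fun s hs => ?_
      rw [uIoc_of_le h23.le] at hs
      simpa using (hlim s (hsub ⟨hs.1.le, hs.2⟩)).norm
  let σ := (s₂ + s₃) / 2
  -- The centre's offset from σ, the half-side of the square and the shift ε are each less than r,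
  -- so horizontally 3r must fit into (s₃ - s₂) / 2; vertically 2r must fit into c - a.
  obtain ⟨r, hr, hr1, hr2⟩ : ∃ r : ℝ, 0 < r ∧ r ≤ (s₃ - s₂) / 8 ∧ r ≤ (c - a) / 4 :=
    ⟨min ((s₃ - s₂) / 8) ((c - a) / 4), lt_min (by linarith) (by linarith),
      min_le_left _ _, min_le_right _ _⟩
  have hzero : ∀ z₀ : ℂ, |z₀.re - σ| < r → a < z₀.im → z₀.im < a + r → p z₀ = 0 := by
    intro z₀ hre him1 him2
    rw [abs_lt] at hre
    have hq : ∀ ε ∈ Ioo 0 r, ∫ s in (0 : ℝ)..ε, p (z₀ + s) = 0 := by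
      intro ε hε
      let q : ℂ → ℂ := fun z => ∫ s in (0 : ℝ)..ε, p (z + s)
      -- The square about z₀ is chosen with its bottom side at height t, where the averaged function
      -- is at most m t. Letting t decrease to `a` gives q z₀ = 0.
      have hbound : ∀ t ∈ Ioo a z₀.im, ‖q z₀‖ ^ 4 ≤ m t * (M * ε) ^ 3 := by
        intro t ht
        have hd : 0 < z₀.im - t := sub_pos.2 ht.2
        have hrange : ∀ z : ℂ, |(z - z₀).re| ≤ z₀.im - t → |(z - z₀).im| ≤ z₀.im - t →
            (s₂ ≤ z.re ∧ z.re + ε ≤ s₃) ∧ a < z.im ∧ z.im ≤ c := by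
          intro z h1 h2
          rw [Complex.sub_re, abs_le] at h1
          rw [Complex.sub_im, abs_le] at h2
          obtain ⟨hε1, hε2⟩ := hε
          obtain ⟨ht1, ht2⟩ := ht
          simp only [σ] at hre
          refine ⟨⟨?_, ?_⟩, ?_, ?_⟩ <;> linarith [hre.1, hre.2, h1.1, h1.2, h2.1, h2.2]
        refine norm_pow_four_le_of_square (z₀ := z₀) hd ?_ ?_ ?_ ?_
        · exact intervalIntegral.integral_nonneg h23.le fun s _ => norm_nonneg _
        · intro z h1 h2
          obtain ⟨-, h3, h4⟩ := hrange z h1 h2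
          exact differentiableAt_integral_translate hU hp fun s _ => by
            simpa using ⟨h3, h4.trans_lt hcb⟩
        · intro z h1 h2
          obtain ⟨⟨h5, h6⟩, h3, h4⟩ := hrange z h1 h2
          have := intervalIntegral.norm_integral_le_of_norm_le_const (a := 0) (b := ε)
            (f := fun s : ℝ => p (z + s)) (C := M) fun s hs => by
              rw [uIoc_of_le hε.1.le] at hs
              have hzs : z + s = ((z.re + s : ℝ) : ℂ) + z.im * Complex.I := by
                apply Complex.ext <;> simp
              rw [hzs]
              exact hM (z.re + s) ⟨by linarith [hs.1], by linarith [hs.2]⟩ z.im ⟨h3, h4⟩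
          simpa [abs_of_pos hε.1] using this
        · intro z h1 h2
          have h2' : z.im = t := by simpa [sub_eq_iff_eq_add] using h2
          obtain ⟨⟨h5, h6⟩, h3, h4⟩ := hrange z h1 (by rw [h2, abs_neg, abs_of_pos hd])
          have hc := (hslice t ⟨ht.1, by rw [← h2']; exact h4⟩).norm
          calc ‖q z‖ ≤ ∫ s in (0 : ℝ)..ε, ‖p (z + s)‖ :=
                intervalIntegral.norm_integral_le_integral_norm hε.1.le
            _ = ∫ s in (0 : ℝ)..ε, ‖p (((z.re + s : ℝ) : ℂ) + t * Complex.I)‖ := by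
                refine intervalIntegral.integral_congr fun s _ => ?_
                have hzs : z + s = ((z.re + s : ℝ) : ℂ) + t * Complex.I := by
                  apply Complex.ext <;> simp [h2']
                rw [hzs]
            _ = ∫ s in z.re..z.re + ε, ‖p ((s : ℂ) + t * Complex.I)‖ := by
                rw [intervalIntegral.integral_comp_add_left
                  (fun s : ℝ => ‖p ((s : ℂ) + t * Complex.I)‖)]
                simp
            _ ≤ m t := by
                refine intervalIntegral.integral_mono_interval h5 (by linarith [hε.1]) h6
                  (Eventually.of_forall fun s => norm_nonneg _) (hc.intervalIntegrable _ _)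
      have hlim4 : Tendsto (fun t => m t * (M * ε) ^ 3) (𝓝[>] a) (𝓝 0) := by
        simpa using hm.mul_const ((M * ε) ^ 3)
      have h0 : ‖q z₀‖ ^ 4 ≤ 0 := ge_of_tendsto hlim4 (by
        filter_upwards [Ioo_mem_nhdsGT him1] with t ht using hbound t ht)
      have : ‖q z₀‖ ^ 4 = 0 := le_antisymm h0 (by positivity)
      simpa using this
    have hcz : Continuous fun s : ℝ => p (z₀ + s) :=
      hp.continuousOn.comp_continuous (by fun_prop) fun s => by
        simpa using ⟨him1, by linarith⟩
    -- All short averages starting at z₀ vanish; their right derivative at ε = 0 is p z₀.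
    have hder := (intervalIntegral.integral_hasDerivAt_right
      (hcz.intervalIntegrable 0 0) (hcz.stronglyMeasurableAtFilter _ _)
      hcz.continuousAt).hasDerivWithinAt (s := Ioi 0)
    have hder0 : HasDerivWithinAt (fun ε : ℝ => ∫ s in (0 : ℝ)..ε, p (z₀ + s)) 0 (Ioi 0) 0 := by
      refine (hasDerivWithinAt_const (0 : ℝ) (Ioi (0 : ℝ)) (0 : ℂ)).congr_of_eventuallyEq ?_
        (by simp)
      filter_upwards [Ioo_mem_nhdsGT hr] with ε hε using hq ε hε
    simpa using (uniqueDiffWithinAt_Ioi (0 : ℝ)).eq_deriv _ hder hder0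
  have hpre : IsPreconnected {z : ℂ | a < z.im ∧ z.im < b} :=
    ((convex_halfSpace_im_gt a).inter (convex_halfSpace_im_lt b)).isPreconnected
  refine (hp.analyticOnNhd hU).eqOn_zero_of_preconnected_of_eventuallyEq_zero hpre
    (z₀ := ⟨σ, a + r / 2⟩) ?_ ?_
  · exact ⟨by simp; linarith, by simp; linarith⟩
  · have hopen : IsOpen {z : ℂ | |z.re - σ| < r ∧ a < z.im ∧ z.im < a + r} :=
      (isOpen_lt (f := fun z : ℂ => |z.re - σ|) (by fun_prop) continuous_const).inter
        (isOpen_strip a (a + r))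
    filter_upwards [hopen.mem_nhds (show (⟨σ, a + r / 2⟩ : ℂ) ∈ _ from
      ⟨by simpa using hr, by simp; linarith, by simp; linarith⟩)] with z hz
    exact hzero z hz.1 hz.2.1 hz.2.2

end ComplexBoundary

/-! ### One-parameter subgroups, σ-compactness and left-invariant derivatives. -/

section LieGroupFacts

variable {E : Type*} [NormedAddCommGroup E] [NormedSpace ℝ E]
  {G : Type*} [TopologicalSpace G] [ChartedSpace E G] [Group G]

theorem expCurve_zero (h : GroupLieAlgebra 𝓘(ℝ, E) G) : expCurve h 0 = 1 := by
  unfold expCurve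
  split_ifs with hx
  · exact hx.choose_spec.map_zero
  · rfl

theorem expCurve_add (h : GroupLieAlgebra 𝓘(ℝ, E) G) (s t : ℝ) :
    expCurve h (s + t) = expCurve h s * expCurve h t := by
  unfold expCurve
  split_ifs with hx
  · exact hx.choose_spec.map_add s t
  · simp

theorem expCurve_neg (h : GroupLieAlgebra 𝓘(ℝ, E) G) (t : ℝ) :
    expCurve h (-t) = (expCurve h t)⁻¹ := by
  rw [eq_inv_iff_mul_eq_one, ← expCurve_add, neg_add_cancel, expCurve_zero]

theorem continuous_expCurve (h : GroupLieAlgebra 𝓘(ℝ, E) G) : Continuous (expCurve h) :=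
  (contMDiff_expCurve h).continuous

/-- A connected locally compact group is `σ`-compact. -/
theorem sigmaCompactSpace_of_connected (G : Type*) [TopologicalSpace G] [Group G]
    [IsTopologicalGroup G] [LocallyCompactSpace G] [ConnectedSpace G] : SigmaCompactSpace G := by
  obtain ⟨K, hK, hK1⟩ := exists_compact_mem_nhds (1 : G)
  let L : Set G := K ∪ K⁻¹
  have hL : IsCompact L := hK.union hK.inv
  have hL1 : L ∈ 𝓝 (1 : G) := mem_of_superset hK1 subset_union_left
  -- A subgroup containing a neighbourhood of 1 is open, hence closed, hence everything by
  -- connectedness. So G is the union of the compact powers of the symmetric set L.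
  have hopen : IsOpen (Subgroup.closure L : Set G) :=
    (Subgroup.closure L).isOpen_of_mem_nhds (g := 1) (mem_of_superset hL1 Subgroup.subset_closure)
  have huniv : (Subgroup.closure L : Set G) = univ :=
    IsClopen.eq_univ ⟨Subgroup.isClosed_of_isOpen _ hopen, hopen⟩ ⟨1, one_mem _⟩
  have hLinv : L⁻¹ = L := by simp [L, union_comm]
  have hpow : ∀ g : G, g ∈ ⋃ n : ℕ, L ^ n := by
    intro g
    have hg : g ∈ Subgroup.closure L := by
      rw [← SetLike.mem_coe, huniv]; trivial
    induction hg using Subgroup.closure_induction with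
    | mem x hx => exact mem_iUnion.2 ⟨1, by simpa using hx⟩
    | one => exact mem_iUnion.2 ⟨0, by simp⟩
    | mul x y _ _ hx hy =>
      obtain ⟨m, hm⟩ := mem_iUnion.1 hx
      obtain ⟨n, hn⟩ := mem_iUnion.1 hy
      exact mem_iUnion.2 ⟨m + n, by rw [pow_add]; exact mul_mem_mul hm hn⟩
    | inv x _ hx =>
      obtain ⟨m, hm⟩ := mem_iUnion.1 hx
      refine mem_iUnion.2 ⟨m, ?_⟩
      rw [← hLinv, inv_pow]
      exact Set.inv_mem_inv.2 hm
  have hLn : ∀ n : ℕ, IsCompact (L ^ n) := by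
    intro n
    induction n with
    | zero => simp
    | succ n ih => rw [pow_succ]; exact ih.mul hL
  rw [← isSigmaCompact_univ_iff, ← eq_univ_of_forall hpow]
  exact isSigmaCompact_iUnion_of_isCompact _ hLn

section RightDeriv

variable {V : Type*} [NormedAddCommGroup V] [NormedSpace ℝ V]

/-- The derivative in direction of the left invariant vector field of `h`. -/
def rightDeriv (h : GroupLieAlgebra 𝓘(ℝ, E) G) (ψ : G → V) (g : G) : V :=
  deriv (fun t : ℝ => ψ (g * expCurve h t)) 0

variable [LieGroup 𝓘(ℝ, E) ω G]

theorem contMDiff_mul_expCurve (h : GroupLieAlgebra 𝓘(ℝ, E) G) {ψ : G → V}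
    (hψ : ContMDiff 𝓘(ℝ, E) 𝓘(ℝ, V) ∞ ψ) :
    ContMDiff (𝓘(ℝ, E).prod 𝓘(ℝ, ℝ)) 𝓘(ℝ, V) ∞
      (fun p : G × ℝ => ψ (p.1 * expCurve h p.2)) := by
  have := (contMDiff_expCurve h).comp (contMDiff_snd (I := 𝓘(ℝ, E)) (M := G) (J := 𝓘(ℝ, ℝ)) (N := ℝ))
  exact hψ.comp (contMDiff_fst.mul this)

/-- Smooth dependence of a derivative on parameters: the derivative in t at 0 is a smooth family of
linear maps on ℝ, evaluated at 1. -/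
theorem contMDiff_rightDeriv (h : GroupLieAlgebra 𝓘(ℝ, E) G) {ψ : G → V}
    (hψ : ContMDiff 𝓘(ℝ, E) 𝓘(ℝ, V) ∞ ψ) :
    ContMDiff 𝓘(ℝ, E) 𝓘(ℝ, V) ∞ (rightDeriv h ψ) := by
  intro g
  have h1 := ContMDiffAt.mfderiv (n := ∞) (m := ∞) (I := 𝓘(ℝ, ℝ)) (I' := 𝓘(ℝ, V)) (J := 𝓘(ℝ, E))
    (x₀ := g) (fun (g : G) (t : ℝ) => ψ (g * expCurve h t)) (fun _ => (0 : ℝ))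
    (contMDiff_mul_expCurve h hψ _) contMDiffAt_const (by simp)
  have h2 := h1.clm_apply (contMDiffAt_const (c := (1 : ℝ)))
  refine h2.congr_of_eventuallyEq (Eventually.of_forall fun x => ?_)
  simp [inTangentCoordinates_model_space, rightDeriv, mfderiv_eq_fderiv]

/-- The homomorphism property carries the derivative at time 0, based at g exp(th), to time t. -/
theorem hasDerivAt_rightDeriv (h : GroupLieAlgebra 𝓘(ℝ, E) G) {ψ : G → V}
    (hψ : ContMDiff 𝓘(ℝ, E) 𝓘(ℝ, V) ∞ ψ) (g : G) (t : ℝ) :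
    HasDerivAt (fun t : ℝ => ψ (g * expCurve h t)) (rightDeriv h ψ (g * expCurve h t)) t := by
  have hsm : ∀ g : G, Differentiable ℝ (fun t : ℝ => ψ (g * expCurve h t)) := by
    intro g
    have := (contMDiff_mul_expCurve h hψ).comp
      ((contMDiff_const (c := g)).prodMk (contMDiff_id (I := 𝓘(ℝ, ℝ)) (M := ℝ)))
    exact this.contDiff.differentiable (by simp)
  have h1 : HasDerivAt (fun s : ℝ => ψ (g * expCurve h t * expCurve h s))
      (rightDeriv h ψ (g * expCurve h t)) (t - t) := by
    rw [sub_self]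
    exact (hsm _ 0).hasDerivAt
  refine (h1.comp_sub_const t t).congr_of_eventuallyEq (Eventually.of_forall fun s => ?_)
  simp [mul_assoc, ← expCurve_add]

end RightDeriv

/-! ### Haar measure under right translations. -/

section Modular

variable [IsTopologicalGroup G] [LocallyCompactSpace G] [SecondCountableTopology G]
  [MeasurableSpace G] [BorelSpace G]

/-- A right translate of μ is again left invariant, so uniqueness of Haar measure makes it a
multiple of μ. -/
theorem integral_mul_right_eq_modularCharacter_smul (μ : Measure G) [μ.IsHaarMeasure]
    {V : Type*} [NormedAddCommGroup V] [NormedSpace ℝ V] (F : G → V) (x : G) :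
    ∫ g, F (g * x) ∂μ = (Measure.modularCharacter x : ℝ) • ∫ g, F g ∂μ := by
  have h1 : Measure.map (· * x) μ = Measure.modularCharacter x • μ := by
    change _ = Measure.modularCharacterFun x • μ
    rw [Measure.modularCharacterFun_eq_haarScalarFactor μ]
    exact Measure.isMulLeftInvariant_eq_smul _ μ
  have h2 := (Homeomorph.mulRight x).measurableEmbedding.integral_map (μ := μ) F
  have h3 : Measure.map (Homeomorph.mulRight x) μ = Measure.modularCharacter x • μ := h1
  rw [h3, integral_smul_nnreal_measure] at h2
  exact h2.symm

/-- The character is the quotient of ∫ f(gx) dg by ∫ f for a nonnegative bump function f. For x in a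
compact set the integrands have a common compact support, so the numerator is continuous. -/
theorem continuous_modularCharacter :
    Continuous fun x : G => (Measure.modularCharacter x : ℝ) := by
  let μ : Measure G := Measure.haar
  obtain ⟨⟨f, hf⟩, hfc, hf0, hf1⟩ :
    ∃ f : C(G, ℝ), HasCompactSupport f ∧ 0 ≤ f ∧ f 1 ≠ 0 := exists_continuous_nonneg_pos 1
  have hpos : 0 < ∫ g, f g ∂μ := hf.integral_pos_of_hasCompactSupport_nonneg_nonzero hfc hf0 hf1
  have heq : (fun x : G => (Measure.modularCharacter x : ℝ)) =
      fun x => (∫ g, f (g * x) ∂μ) / ∫ g, f g ∂μ := by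
    ext x
    rw [integral_mul_right_eq_modularCharacter_smul, smul_eq_mul, mul_div_cancel_right₀ _ hpos.ne']
  rw [heq]
  refine Continuous.div_const ?_ _
  rw [continuous_iff_continuousAt]
  intro x
  obtain ⟨K, hK, hKx⟩ := exists_compact_mem_nhds x
  refine ContinuousOn.continuousAt (s := K) ?_ hKx
  refine continuousOn_integral_of_compact_support (k := tsupport f * K⁻¹)
    (IsCompact.mul hfc hK.inv) (by fun_prop) ?_
  intro y g hy hg
  by_contra hne
  exact hg ⟨g * y, subset_tsupport _ hne, y⁻¹, inv_mem_inv.2 hy, by simp⟩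

/-- Right translation along a one-parameter group scales Haar measure exponentially. -/
theorem exists_integral_mul_expCurve (μ : Measure G) [μ.IsHaarMeasure]
    (h : GroupLieAlgebra 𝓘(ℝ, E) G) :
    ∃ c : ℝ, ∀ {V : Type u} [NormedAddCommGroup V] [NormedSpace ℝ V] (F : G → V) (t : ℝ),
      ∫ g, F (g * expCurve h t) ∂μ = Real.exp (c * t) • ∫ g, F g ∂μ := by
  -- The logarithm of the modular character along exp(th) is additive and continuous in t, hence
  -- linear; c is its slope.
  let L : ℝ →+ ℝ :=
    { toFun := fun t => Real.log (Measure.modularCharacter (expCurve h t))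
      map_zero' := by simp [expCurve_zero]
      map_add' := fun s t => by
        rw [expCurve_add, map_mul, NNReal.coe_mul, Real.log_mul]
        · exact (NNReal.coe_pos.2 (Measure.modularCharacterFun_pos _)).ne'
        · exact (NNReal.coe_pos.2 (Measure.modularCharacterFun_pos _)).ne' }
  have hL : Continuous L := by
    refine Continuous.log (continuous_modularCharacter.comp (continuous_expCurve h)) fun t => ?_
    exact (NNReal.coe_pos.2 (Measure.modularCharacterFun_pos _)).ne'
  refine ⟨L 1, fun F t => ?_⟩
  rw [integral_mul_right_eq_modularCharacter_smul]
  congr 1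
  have h1 : L t = t * L 1 := by
    have := (L.toRealLinearMap hL).map_smul t 1
    simpa using this
  rw [mul_comm, ← h1]
  exact (Real.exp_log (NNReal.coe_pos.2 (Measure.modularCharacterFun_pos _))).symm

end Modular

end LieGroupFacts

/-! ### The derived operator of U_h and finite order of its distribution vectors. -/

section Operators

variable {E : Type*} [NormedAddCommGroup E] [NormedSpace ℝ E]
  {G : Type*} [TopologicalSpace G] [ChartedSpace E G] [Group G]
  {𝓗 : Type*} [NormedAddCommGroup 𝓗] [InnerProductSpace ℂ 𝓗]
  {τ : G ≃* G} {hτ : ∀ g : G, τ (τ g) = g}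

namespace AntiunitaryRep

variable (U : AntiunitaryRep τ hτ 𝓗)

theorem op_one (v : 𝓗) : U.op 1 v = v := by simp [op]

theorem op_op_inv (g : G) (v : 𝓗) : U.op g (U.op g⁻¹ v) = v := by
  rw [← op_mul, mul_inv_cancel, op_one]

theorem norm_op (g : G) (v : 𝓗) : ‖U.op g v‖ = ‖v‖ :=
  (U.toHom (SemidirectProduct.inl g)).1.norm_map v

theorem inner_op_op (g : G) (v w : 𝓗) : ⟪U.op g v, U.op g w⟫_ℂ = ⟪v, w⟫_ℂ :=
  LinearIsometry.inner_map_map ⟨(U.op g).toLinearMap, U.norm_op g⟩ v w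

theorem inner_op_left (g : G) (v w : 𝓗) : ⟪U.op g v, w⟫_ℂ = ⟪v, U.op g⁻¹ w⟫_ℂ := by
  rw [← U.inner_op_op g v, op_op_inv]

theorem continuous_op (v : 𝓗) : Continuous fun g : G => U.op g v := U.continuous_orbit v

/-- The derived operator of `U_h` maps differentiable orbits to their velocity fields. -/
theorem hasDerivAt_orbit (h : GroupLieAlgebra 𝓘(ℝ, E) G) {v v' : 𝓗}
    (hv : HasDerivAt (fun t : ℝ => U.op (expCurve h t) v) v' 0) (t : ℝ) :
    HasDerivAt (fun t : ℝ => U.op (expCurve h t) v) (U.op (expCurve h t) v') t := by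
  have h1 := ((U.op (expCurve h t)).restrictScalars ℝ).hasFDerivAt.comp_hasDerivAt (0 : ℝ) hv
  rw [← sub_self t] at h1
  refine (h1.comp_sub_const t t).congr_of_eventuallyEq (Eventually.of_forall fun s => ?_)
  simp [← op_mul, ← expCurve_add]

theorem oneParam_hasDerivAt (h : GroupLieAlgebra 𝓘(ℝ, E) G) {v : 𝓗}
    (hv : v ∈ U.oneParamSmoothVectors h) :
    HasDerivAt (fun t : ℝ => U.op (expCurve h t) v) (U.dU h v) 0 := by
  have hv' : ContDiff ℝ ∞ fun t : ℝ => U.op (expCurve h t) v := hv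
  exact (hv'.differentiable (by simp) 0).hasDerivAt

theorem dU_mem_oneParamSmoothVectors (h : GroupLieAlgebra 𝓘(ℝ, E) G) {v : 𝓗}
    (hv : v ∈ U.oneParamSmoothVectors h) : U.dU h v ∈ U.oneParamSmoothVectors h := by
  have h1 : (fun t : ℝ => U.op (expCurve h t) (U.dU h v)) =
      deriv fun t : ℝ => U.op (expCurve h t) v := by
    ext t
    exact (U.hasDerivAt_orbit h (U.oneParam_hasDerivAt h hv) t).deriv.symm
  have hv' : ContDiff ℝ ∞ fun t : ℝ => U.op (expCurve h t) v := hv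
  change ContDiff ℝ ∞ fun t : ℝ => U.op (expCurve h t) (U.dU h v)
  rw [h1]
  exact (contDiff_infty_iff_deriv.1 hv').2

/-- The derived operator `dU(h)` on the smooth vectors of `U_h`. -/
def dULinear (h : GroupLieAlgebra 𝓘(ℝ, E) G) :
    U.oneParamSmoothVectors h →ₗ[ℂ] U.oneParamSmoothVectors h where
  toFun v := ⟨U.dU h v, U.dU_mem_oneParamSmoothVectors h v.2⟩
  map_add' v w := by
    have := (U.oneParam_hasDerivAt h v.2).add (U.oneParam_hasDerivAt h w.2)
    refine Subtype.ext ?_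
    change U.dU h ((v : 𝓗) + w) = U.dU h v + U.dU h w
    rw [← this.deriv]
    simp [dU, Pi.add_def]
  map_smul' c v := by
    have := (U.oneParam_hasDerivAt h v.2).const_smul c
    refine Subtype.ext ?_
    change U.dU h (c • (v : 𝓗)) = c • U.dU h v
    rw [← this.deriv]
    simp [dU, Pi.smul_def]

theorem coe_dULinear_pow (h : GroupLieAlgebra 𝓘(ℝ, E) G) (n : ℕ)
    (v : U.oneParamSmoothVectors h) :
    (((U.dULinear h ^ n) v : U.oneParamSmoothVectors h) : 𝓗) = (U.dU h)^[n] v := by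
  induction n with
  | zero => rfl
  | succ n ih => rw [Function.iterate_succ_apply', ← ih, pow_succ']; rfl

/-- The jet `(v, dU(h) v, …, dU(h)^n v)`. -/
def jet (h : GroupLieAlgebra 𝓘(ℝ, E) G) (n : ℕ) :
    U.oneParamSmoothVectors h →ₗ[ℂ] (Fin (n + 1) → 𝓗) :=
  LinearMap.pi fun k => (U.oneParamSmoothVectors h).subtype ∘ₗ (U.dULinear h ^ (k : ℕ))

theorem jet_apply (h : GroupLieAlgebra 𝓘(ℝ, E) G) (n : ℕ) (v : U.oneParamSmoothVectors h)
    (k : Fin (n + 1)) : U.jet h n v k = (U.dU h)^[k] v :=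
  U.coe_dULinear_pow h k v

/-- Every distribution vector of `U_h` is given by a continuous functional of a finite jet. -/
theorem exists_jet_functional (h : GroupLieAlgebra 𝓘(ℝ, E) G)
    (η : U.oneParamDistributionVectors h) :
    ∃ (n : ℕ) (L : (Fin (n + 1) → 𝓗) →L[ℂ] ℂ), ∀ v : U.oneParamSmoothVectors h,
      starRingEnd ℂ (η.1 v) = L (U.jet h n v) := by
  let e : U.oneParamSmoothVectors h →ₗ[ℂ] ℂ :=
    { toFun := fun v => starRingEnd ℂ (η.1 v)
      map_add' := by simp
      map_smul' := by simp }
  -- A neighbourhood of 0 in the initial topology constrains only finitely many dU(h)^k v; n bounds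
  -- these k. Conjugating η into `e` makes it linear, so that Hahn–Banach applies.
  obtain ⟨n, ε, hε, hbound⟩ : ∃ (n : ℕ) (ε : ℝ), 0 < ε ∧
      ∀ v, ‖U.jet h n v‖ ≤ ε → ‖e v‖ ≤ 1 := by
    let _ := U.oneParamSmoothTopology h
    have hη : Continuous η.1 := η.2
    have h1 : ∀ᶠ v in 𝓝 (0 : U.oneParamSmoothVectors h), ‖η.1 v‖ ≤ 1 := by
      have := (hη.norm.tendsto 0)
      rw [map_zero, norm_zero] at this
      exact this.eventually_le_const one_pos
    rw [nhds_induced, eventually_comap, nhds_pi] at h1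
    obtain ⟨⟨I, r⟩, ⟨hI, hr⟩, hsub⟩ :=
      (hasBasis_pi fun n : ℕ => Metric.nhds_basis_ball
        (x := (U.dU h)^[n] ((0 : U.oneParamSmoothVectors h) : 𝓗))).eventually_iff.1 h1
    obtain ⟨n, hn⟩ := hI.bddAbove
    obtain ⟨ε, hε, hεr⟩ : ∃ ε : ℝ, 0 < ε ∧ ∀ i ∈ I, ε < r i := by
      obtain ⟨ε, hε⟩ := ((hI.eventually_all (l := 𝓝[>] (0 : ℝ)) (p := fun i ε => ε < r i)).2
        fun i hi => mem_of_superset (Ioo_mem_nhdsGT (hr i hi)) fun x hx => hx.2).and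
          self_mem_nhdsWithin |>.exists
      exact ⟨ε, hε.2, hε.1⟩
    refine ⟨n, ε, hε, fun v hv => ?_⟩
    have := hsub (x := fun n => (U.dU h)^[n] (v : 𝓗)) ?_ v rfl
    · simpa [e] using this
    · intro i hi
      beta_reduce
      rw [← coe_dULinear_pow, ← coe_dULinear_pow, map_zero, Submodule.coe_zero,
        mem_ball_zero_iff, coe_dULinear_pow]
      have h2 := norm_le_pi_norm (U.jet h n v) ⟨i, Nat.lt_succ_of_le (hn hi)⟩
      rw [jet_apply] at h2
      exact (h2.trans hv).trans_lt (hεr i hi)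
  -- If `e v` were nonzero, rescaling v to value 2 would keep the jet zero and violate the bound by
  -- 1. Hence `e` factors through the jet, and the factor is bounded on the range and extends.
  have hker : ∀ v, U.jet h n v = 0 → e v = 0 := by
    intro v hv
    by_contra hne
    have h1 := hbound (((2 : ℂ) / e v) • v) (by rw [_root_.map_smul, hv]; simpa using hε.le)
    rw [_root_.map_smul, smul_eq_mul, div_mul_cancel₀ _ hne] at h1
    norm_num at h1
  obtain ⟨f, hf⟩ : ∃ f : Module.Dual ℂ (Fin (n + 1) → 𝓗), (U.jet h n).dualMap f = e := by
    rw [← LinearMap.mem_range, LinearMap.range_dualMap_eq_dualAnnihilator_ker,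
      Submodule.mem_dualAnnihilator]
    exact fun v hv => hker v hv
  have hf' : ∀ v, f (U.jet h n v) = e v := fun v => by rw [← hf]; rfl
  let p := LinearMap.range (U.jet h n)
  have hpb : ∀ x : p, ‖(f ∘ₗ p.subtype) x‖ ≤ 1 / ε * ‖x‖ := by
    refine LinearMap.bound_of_ball_bound' hε 1 _ ?_
    rintro ⟨_, v, rfl⟩ hv
    have := hbound v (by simpa using hv)
    simpa [hf'] using this
  obtain ⟨L, hL, -⟩ := exists_extension_norm_eq p ((f ∘ₗ p.subtype).mkContinuous (1 / ε) hpb)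
  refine ⟨n, L, fun v => ?_⟩
  have := hL ⟨U.jet h n v, v, rfl⟩
  rw [this]
  simp [hf', e]

end AntiunitaryRep

end Operators

/-! ### Differentiation under the integral sign. -/

section ParametricIntegral

/-- Differentiation under the integral sign for integrands supported in a fixed compact set. -/
theorem hasDerivAt_integral_of_compact_support {X V : Type*} [TopologicalSpace X]
    [T2Space X] [SecondCountableTopology X] [MeasurableSpace X] [BorelSpace X] (μ : Measure X) [IsFiniteMeasureOnCompacts μ]
    [NormedAddCommGroup V] [NormedSpace ℝ V]
    {K K' : ℝ → X → V} {C : Set X} (hC : IsCompact C)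
    (hK : ∀ t, Continuous (K t))
    (hK' : Continuous (Function.uncurry K')) (hd : ∀ t x, HasDerivAt (K · x) (K' t x) t)
    (hzero : ∀ t ∈ Icc (-1 : ℝ) 1, ∀ x ∉ C, K t x = 0) :
    HasDerivAt (fun t => ∫ x, K t x ∂μ) (∫ x, K' 0 x ∂μ) 0 := by
  obtain ⟨M, hM⟩ := ((isCompact_Icc (a := (-1 : ℝ)) (b := 1)).prod hC).exists_bound_of_continuousOn
    hK'.continuousOn
  have hzero' : ∀ t ∈ Ioo (-1 : ℝ) 1, ∀ x ∉ C, K' t x = 0 := by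
    intro t ht x hx
    refine (hd t x).unique ((hasDerivAt_const t (0 : V)).congr_of_eventuallyEq ?_)
    filter_upwards [isOpen_Ioo.mem_nhds ht] with s hs
    exact hzero s ⟨hs.1.le, hs.2.le⟩ x hx
  have hK0 : Integrable (K 0) μ := by
    refine ((hK 0).continuousOn.integrableOn_compact hC).integrable_of_forall_notMem_eq_zero
      fun x hx => hzero 0 (by simp) x hx
  refine (hasDerivAt_integral_of_dominated_loc_of_deriv_le (μ := μ) (F := K) (F' := K')
    (s := Ioo (-1) 1) (bound := C.indicator fun _ => M) (Ioo_mem_nhds (by simp) (by simp))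
    (Eventually.of_forall fun t => (hK t).aestronglyMeasurable) hK0
    (hK'.comp (by fun_prop : Continuous fun x => ((0 : ℝ), x))).aestronglyMeasurable ?_ ?_ ?_).2
  · refine Eventually.of_forall fun x t ht => ?_
    by_cases hx : x ∈ C
    · simpa [hx] using hM (t, x) ⟨⟨ht.1.le, ht.2.le⟩, hx⟩
    · simp [hx, hzero' t ht x hx]
  · exact (integrable_indicator_iff hC.measurableSet).2 (integrableOn_const hC.measure_ne_top)
  · exact Eventually.of_forall fun x t _ => hd t x

end ParametricIntegral

/-! ### Smeared vectors and their pairing with distribution vectors of U_h. -/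

section Smearing

variable {E : Type*} [NormedAddCommGroup E] [NormedSpace ℝ E]
  {G : Type*} [TopologicalSpace G] [ChartedSpace E G] [Group G]
  {𝓗 : Type*} [NormedAddCommGroup 𝓗] [InnerProductSpace ℂ 𝓗]
  {τ : G ≃* G} {hτ : ∀ g : G, τ (τ g) = g}

theorem tsupport_rightDeriv_subset [IsTopologicalGroup G]
    {V : Type*} [NormedAddCommGroup V] [NormedSpace ℝ V] (h : GroupLieAlgebra 𝓘(ℝ, E) G)
    (φ : G → V) : tsupport (rightDeriv h φ) ⊆ tsupport φ := by
  refine closure_minimal (fun g hg => ?_) (isClosed_tsupport φ)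
  by_contra hne
  refine hg ?_
  have hcont : Continuous fun t : ℝ => g * expCurve h t :=
    continuous_const.mul (continuous_expCurve h)
  have hev : ∀ᶠ t in 𝓝 (0 : ℝ), g * expCurve h t ∈ (tsupport φ)ᶜ :=
    hcont.continuousAt.eventually_mem
      ((isClosed_tsupport φ).isOpen_compl.mem_nhds (by simpa [expCurve_zero] using hne))
  have h0 : (fun t : ℝ => φ (g * expCurve h t)) =ᶠ[𝓝 0] fun _ => 0 :=
    hev.mono fun t ht => image_eq_zero_of_notMem_tsupport ht
  simp [rightDeriv, h0.deriv_eq]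

/-- The generator of the one-parameter group `φ ↦ e^{ct} φ (· exp (t h))` of weighted right
translations. -/
def weightedDeriv (c : ℝ) (h : GroupLieAlgebra 𝓘(ℝ, E) G) (φ : G → ℝ) (g : G) : ℝ :=
  c * φ g + rightDeriv h φ g

theorem tsupport_weightedDeriv_subset [IsTopologicalGroup G] (c : ℝ)
    (h : GroupLieAlgebra 𝓘(ℝ, E) G) (φ : G → ℝ) :
    tsupport (weightedDeriv c h φ) ⊆ tsupport φ := by
  refine closure_minimal (fun g hg => ?_) (isClosed_tsupport φ)
  by_contra hne
  have h1 : rightDeriv h φ g = 0 :=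
    image_eq_zero_of_notMem_tsupport fun hm => hne (tsupport_rightDeriv_subset h φ hm)
  exact hg (by simp [weightedDeriv, h1, image_eq_zero_of_notMem_tsupport hne])

variable [LieGroup 𝓘(ℝ, E) ω G]

theorem contMDiff_weightedDeriv (c : ℝ) (h : GroupLieAlgebra 𝓘(ℝ, E) G) {φ : G → ℝ}
    (hφ : ContMDiff 𝓘(ℝ, E) 𝓘(ℝ, ℝ) ∞ φ) :
    ContMDiff 𝓘(ℝ, E) 𝓘(ℝ, ℝ) ∞ (weightedDeriv c h φ) :=
  (contMDiff_const.mul hφ).add (contMDiff_rightDeriv h hφ)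

namespace AntiunitaryRep

variable (U : AntiunitaryRep τ hτ 𝓗)
variable [IsTopologicalGroup G] [LocallyCompactSpace G] [SecondCountableTopology G] [T2Space G]
  [MeasurableSpace G] [BorelSpace G] (μ : Measure G) [μ.IsHaarMeasure]

/-- The smeared operator `∫ φ(g) U(g)⁻¹ dg`. -/
def smear (φ : G → ℝ) (ξ : 𝓗) : 𝓗 := ∫ g, φ g • U.op g⁻¹ ξ ∂μ

theorem continuous_smear_integrand {φ : G → ℝ} (hφ : Continuous φ) (ξ : 𝓗) :
    Continuous fun g => φ g • U.op g⁻¹ ξ :=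
  hφ.smul ((U.continuous_op ξ).comp continuous_inv)

theorem integrable_smear {φ : G → ℝ} (hφ : Continuous φ) (hc : HasCompactSupport φ) (ξ : 𝓗) :
    Integrable (fun g => φ g • U.op g⁻¹ ξ) μ :=
  (U.continuous_smear_integrand hφ ξ).integrable_of_hasCompactSupport hc.smul_right

/-- `smear` as a bounded operator. -/
def smearCLM {φ : G → ℝ} (hφ : Continuous φ) (hc : HasCompactSupport φ) : 𝓗 →L[ℂ] 𝓗 :=
  LinearMap.mkContinuous
    { toFun := U.smear μ φ
      map_add' := fun ξ ζ => by
        simp only [smear, map_add, smul_add]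
        exact integral_add (U.integrable_smear μ hφ hc ξ) (U.integrable_smear μ hφ hc ζ)
      map_smul' := fun a ξ => by
        simp only [smear, _root_.map_smul, RingHom.id_apply]
        rw [← integral_smul]
        exact integral_congr_ae (Eventually.of_forall fun g => smul_comm _ _ _) }
    (∫ g, ‖φ g‖ ∂μ) fun ξ => by
      refine (norm_integral_le_integral_norm _).trans ?_
      simp [norm_smul, norm_op, integral_mul_const]

variable [CompleteSpace 𝓗]

theorem op_smear {φ : G → ℝ} (hφ : Continuous φ) (hc : HasCompactSupport φ) (x : G) (ξ : 𝓗) :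
    U.op x (U.smear μ φ ξ) = ∫ g, φ g • U.op (g * x⁻¹)⁻¹ ξ ∂μ := by
  rw [smear, ← ContinuousLinearMap.integral_comp_comm _ (U.integrable_smear μ hφ hc ξ)]
  refine integral_congr_ae (Eventually.of_forall fun g => ?_)
  simp only [mul_inv_rev, inv_inv, op_mul]
  exact ((U.op x).restrictScalars ℝ).map_smul _ _

/-- The one-parameter group acts on smeared operators through right translations weighted with
rate `c`. -/
def IsHaarRate (h : GroupLieAlgebra 𝓘(ℝ, E) G) (c : ℝ) : Prop :=
  ∀ {φ : G → ℝ}, Continuous φ → HasCompactSupport φ → ∀ (ξ : 𝓗) (t : ℝ),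
    U.op (expCurve h t) (U.smear μ φ ξ) =
      U.smear μ (fun g => Real.exp (c * t) * φ (g * expCurve h t)) ξ

/-- U_h(t)U(g)⁻¹ = U(g exp(-th))⁻¹, and the substitution g ↦ g exp(th) moves the translation onto φ.
Undoing a translation by exp(-th) is what reverses the sign of the rate. -/
theorem exists_isHaarRate (h : GroupLieAlgebra 𝓘(ℝ, E) G) : ∃ c : ℝ, U.IsHaarRate μ h c := by
  obtain ⟨c, hc⟩ := exists_integral_mul_expCurve μ h
  refine ⟨-c, fun {φ} hφ hφc ξ t => ?_⟩
  have h1 := hc (fun g => φ (g * expCurve h t) • U.op g⁻¹ ξ) (-t)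
  simp only [mul_assoc, ← expCurve_add, neg_add_cancel, expCurve_zero, mul_one] at h1
  rw [U.op_smear μ hφ hφc, ← expCurve_neg, h1, smear, ← integral_smul]
  simp_rw [mul_smul]
  simp

variable {μ}
variable {h : GroupLieAlgebra 𝓘(ℝ, E) G} {c : ℝ}

/-- The flow acts on φ only, so the derivative falls on φ and ξ may be any vector of 𝓗. The compact
set in the proof contains the supports of all translates with |t| ≤ 1. -/
theorem hasDerivAt_op_smear (hU : U.IsHaarRate μ h c) {φ : G → ℝ}
    (hφ : ContMDiff 𝓘(ℝ, E) 𝓘(ℝ, ℝ) ∞ φ) (hφc : HasCompactSupport φ) (ξ : 𝓗) :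
    HasDerivAt (fun t : ℝ => U.op (expCurve h t) (U.smear μ φ ξ))
      (U.smear μ (weightedDeriv c h φ) ξ) 0 := by
  have hexp := continuous_expCurve h
  have hφ' := (contMDiff_weightedDeriv c h hφ).continuous
  have key := hasDerivAt_integral_of_compact_support μ
    (K := fun t g => (Real.exp (c * t) * φ (g * expCurve h t)) • U.op g⁻¹ ξ)
    (K' := fun t g => (Real.exp (c * t) * weightedDeriv c h φ (g * expCurve h t)) • U.op g⁻¹ ξ)
    (C := tsupport φ * (expCurve h '' Icc (-1) 1)⁻¹)
    (IsCompact.mul hφc (isCompact_Icc.image hexp).inv) ?_ ?_ ?_ ?_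
  · refine (key.congr_of_eventuallyEq (Eventually.of_forall fun t => ?_)).congr_deriv ?_
    · exact hU hφ.continuous hφc ξ t
    · simp [smear, expCurve_zero]
  · intro t
    have := hφ.continuous
    have h2 := U.continuous_op ξ
    fun_prop
  · have h2 := U.continuous_op ξ
    simp only [Function.uncurry_def]
    fun_prop
  · intro t g
    refine HasDerivAt.smul_const ?_ _
    have h1 : HasDerivAt (fun t => Real.exp (c * t)) (Real.exp (c * t) * c) t := by
      simpa using ((hasDerivAt_id t).const_mul c).exp
    refine (h1.mul (hasDerivAt_rightDeriv h hφ g t)).congr_deriv ?_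
    simp only [weightedDeriv]
    ring
  · intro t ht g hg
    have : φ (g * expCurve h t) = 0 := by
      by_contra hne
      exact hg ⟨g * expCurve h t, subset_tsupport _ hne, (expCurve h t)⁻¹,
        inv_mem_inv.2 ⟨t, ht, rfl⟩, by simp⟩
    simp [this]

theorem hasCompactSupport_weightedDeriv {φ : G → ℝ} (hφc : HasCompactSupport φ) :
    HasCompactSupport (weightedDeriv c h φ) :=
  hφc.of_isClosed_subset (isClosed_tsupport _) (tsupport_weightedDeriv_subset c h φ)

/-- Smeared vectors are smooth for the one-parameter group. -/
theorem smear_mem_oneParamSmoothVectors (hU : U.IsHaarRate μ h c) {φ : G → ℝ}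
    (hφ : ContMDiff 𝓘(ℝ, E) 𝓘(ℝ, ℝ) ∞ φ) (hφc : HasCompactSupport φ) (ξ : 𝓗) :
    U.smear μ φ ξ ∈ U.oneParamSmoothVectors h := by
  change ContDiff ℝ ∞ fun t : ℝ => U.op (expCurve h t) (U.smear μ φ ξ)
  rw [contDiff_infty]
  intro n
  induction n generalizing φ with
  | zero =>
    exact contDiff_zero.2 ((U.continuous_op _).comp (continuous_expCurve h))
  | succ n ih =>
    have hd := U.hasDerivAt_orbit h (U.hasDerivAt_op_smear hU hφ hφc ξ)
    rw [Nat.cast_add, Nat.cast_one, contDiff_succ_iff_deriv]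
    refine ⟨fun t => (hd t).differentiableAt, by simp, ?_⟩
    rw [show deriv (fun t : ℝ => U.op (expCurve h t) (U.smear μ φ ξ)) = _ from
      funext fun t => (hd t).deriv]
    exact ih (contMDiff_weightedDeriv c h hφ) (hasCompactSupport_weightedDeriv hφc)

theorem dU_smear (hU : U.IsHaarRate μ h c) {φ : G → ℝ}
    (hφ : ContMDiff 𝓘(ℝ, E) 𝓘(ℝ, ℝ) ∞ φ) (hφc : HasCompactSupport φ) (ξ : 𝓗) :
    U.dU h (U.smear μ φ ξ) = U.smear μ (weightedDeriv c h φ) ξ :=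
  (U.hasDerivAt_op_smear hU hφ hφc ξ).deriv

variable (h c) in
theorem iterate_weightedDeriv {φ : G → ℝ}
    (hφ : ContMDiff 𝓘(ℝ, E) 𝓘(ℝ, ℝ) ∞ φ) (hφc : HasCompactSupport φ) (n : ℕ) :
    ContMDiff 𝓘(ℝ, E) 𝓘(ℝ, ℝ) ∞ ((weightedDeriv c h)^[n] φ) ∧
      HasCompactSupport ((weightedDeriv c h)^[n] φ) := by
  induction n with
  | zero => exact ⟨hφ, hφc⟩
  | succ n ih =>
    rw [Function.iterate_succ_apply']
    exact ⟨contMDiff_weightedDeriv c h ih.1, hasCompactSupport_weightedDeriv ih.2⟩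

theorem iterate_dU_smear (hU : U.IsHaarRate μ h c) {φ : G → ℝ}
    (hφ : ContMDiff 𝓘(ℝ, E) 𝓘(ℝ, ℝ) ∞ φ) (hφc : HasCompactSupport φ) (ξ : 𝓗) (n : ℕ) :
    (U.dU h)^[n] (U.smear μ φ ξ) = U.smear μ ((weightedDeriv c h)^[n] φ) ξ := by
  induction n with
  | zero => rfl
  | succ n ih =>
    have := iterate_weightedDeriv h c hφ hφc n
    rw [Function.iterate_succ_apply', Function.iterate_succ_apply', ih,
      U.dU_smear hU this.1 this.2]

/-- A distribution vector of `U_h` becomes a vector after smearing. -/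
theorem exists_smeared_vector (hU : U.IsHaarRate μ h c) {φ : G → ℝ}
    (hφ : ContMDiff 𝓘(ℝ, E) 𝓘(ℝ, ℝ) ∞ φ) (hφc : HasCompactSupport φ)
    (η : U.oneParamDistributionVectors h) :
    ∃ w : 𝓗, ∀ ξ : 𝓗,
      ⟪ξ, w⟫_ℂ = η.1 ⟨U.smear μ φ ξ, U.smear_mem_oneParamSmoothVectors hU hφ hφc ξ⟩ := by
  obtain ⟨n, L, hL⟩ := U.exists_jet_functional h η
  -- The k-th jet component of the smeared vector is ξ smeared with the k-fold weighted derivative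
  -- of φ, a bounded operator in ξ. So the functional is bounded on 𝓗 and Riesz applies.
  let T : 𝓗 →L[ℂ] ℂ := L ∘L ContinuousLinearMap.pi fun k : Fin (n + 1) =>
    U.smearCLM μ (iterate_weightedDeriv h c hφ hφc k).1.continuous
      (iterate_weightedDeriv h c hφ hφc k).2
  refine ⟨(InnerProductSpace.toDual ℂ 𝓗).symm T, fun ξ => ?_⟩
  rw [← inner_conj_symm, InnerProductSpace.toDual_symm_apply, ← Complex.conj_conj (η.1 _), hL]
  congr 1
  change L _ = L _
  congr 1
  ext k
  rw [jet_apply]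
  exact (U.iterate_dU_smear hU hφ hφc ξ k).symm

/-! ### Smearing smooth vectors -/

variable (h) in
/-- The functions `g ↦ dU(h)^n U(g)⁻¹ ξ`. -/
def inverseOrbitJet (ξ : 𝓗) (n : ℕ) : G → 𝓗 :=
  (fun A g => -rightDeriv h A g)^[n] fun g => U.op g⁻¹ ξ

variable (h) in
theorem contMDiff_inverseOrbitJet {ξ : 𝓗} (hξ : ξ ∈ U.smoothVectors E) (n : ℕ) :
    ContMDiff 𝓘(ℝ, E) 𝓘(ℝ, 𝓗) ∞ (U.inverseOrbitJet h ξ n) := by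
  induction n with
  | zero =>
    have hξ' : ContMDiff 𝓘(ℝ, E) 𝓘(ℝ, 𝓗) ∞ fun g : G => U.op g ξ := hξ
    exact hξ'.comp (contMDiff_inv 𝓘(ℝ, E) ∞)
  | succ n ih =>
    rw [inverseOrbitJet, Function.iterate_succ_apply']
    exact (contMDiff_rightDeriv h ih).neg

variable (h) in
-- For n = 0 this is U_h(t)U(g)⁻¹ = U(g exp(-th))⁻¹. It survives differentiation because U_h(t) is
-- bounded and linear and right translations along exp(ℝh) commute. The inverse on exp(th) explains
-- the minus sign in `inverseOrbitJet`.
theorem op_inverseOrbitJet {ξ : 𝓗} (hξ : ξ ∈ U.smoothVectors E) (n : ℕ) (g : G) (t : ℝ) :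
    U.op (expCurve h t) (U.inverseOrbitJet h ξ n g) =
      U.inverseOrbitJet h ξ n (g * expCurve h (-t)) := by
  induction n generalizing g t with
  | zero => simp [inverseOrbitJet, ← op_mul, expCurve_neg]
  | succ n ih =>
    have hs := U.contMDiff_inverseOrbitJet h hξ n
    have h1 := ((U.op (expCurve h t)).restrictScalars ℝ).hasFDerivAt.comp_hasDerivAt (0 : ℝ)
      (hasDerivAt_rightDeriv h hs g 0)
    have h2 := hasDerivAt_rightDeriv h hs (g * expCurve h (-t)) 0
    have h3 := h1.unique (h2.congr_of_eventuallyEq (Eventually.of_forall fun s => ?_))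
    · simp only [inverseOrbitJet, Function.iterate_succ_apply'] at h3 ⊢
      simpa [expCurve_zero] using h3
    · change U.op (expCurve h t) _ = _
      rw [ih]
      simp only [mul_assoc, ← expCurve_add, add_comm]

variable (h) in
theorem hasDerivAt_op_inverseOrbitJet {ξ : 𝓗} (hξ : ξ ∈ U.smoothVectors E) (n : ℕ) (g : G)
    (t : ℝ) : HasDerivAt (fun t => U.op (expCurve h t) (U.inverseOrbitJet h ξ n g))
      (U.inverseOrbitJet h ξ (n + 1) (g * expCurve h (-t))) t := by
  have h1 := (hasDerivAt_rightDeriv h (U.contMDiff_inverseOrbitJet h hξ n) g (-t)).scomp t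
    (hasDerivAt_neg t)
  simp_rw [U.op_inverseOrbitJet h hξ]
  refine h1.congr_deriv ?_
  simp [inverseOrbitJet, Function.iterate_succ_apply']

variable (h) in
theorem iterate_dU_op_inv {ξ : 𝓗} (hξ : ξ ∈ U.smoothVectors E) (n : ℕ) (g : G) :
    (U.dU h)^[n] (U.op g⁻¹ ξ) = U.inverseOrbitJet h ξ n g := by
  induction n with
  | zero => rfl
  | succ n ih =>
    rw [Function.iterate_succ_apply', ih]
    simpa [expCurve_zero, dU] using (U.hasDerivAt_op_inverseOrbitJet h hξ n g 0).deriv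

variable (μ h) in
-- For smooth ξ the derivatives can fall on the orbit map instead of φ. This form lets a functional
-- of the jet be moved under the integral.
theorem iterate_dU_smear_of_smooth {φ : G → ℝ} (hφ : Continuous φ) (hφc : HasCompactSupport φ)
    {ξ : 𝓗} (hξ : ξ ∈ U.smoothVectors E) (n : ℕ) :
    (U.dU h)^[n] (U.smear μ φ ξ) = ∫ g, φ g • U.inverseOrbitJet h ξ n g ∂μ := by
  induction n with
  | zero => rfl
  | succ n ih =>
    have hcont := fun n => (U.contMDiff_inverseOrbitJet h hξ n).continuous
    have hexp := continuous_expCurve h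
    have hint : Integrable (fun g => φ g • U.inverseOrbitJet h ξ n g) μ :=
      (hφ.smul (hcont n)).integrable_of_hasCompactSupport hφc.smul_right
    have key := hasDerivAt_integral_of_compact_support μ
      (K := fun t g => φ g • U.op (expCurve h t) (U.inverseOrbitJet h ξ n g))
      (K' := fun t g => φ g • U.inverseOrbitJet h ξ (n + 1) (g * expCurve h (-t)))
      (C := tsupport φ) hφc ?_ ?_ ?_ ?_
    · rw [Function.iterate_succ_apply', ih, dU]
      refine Eq.trans ?_ (key.deriv.trans (by simp [expCurve_zero]))
      congr 1
      ext t
      rw [← ContinuousLinearMap.integral_comp_comm _ hint]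
      refine integral_congr_ae (Eventually.of_forall fun g => ?_)
      exact ((U.op (expCurve h t)).restrictScalars ℝ).map_smul _ _
    · intro t
      have := hcont n
      fun_prop
    · have := hcont (n + 1)
      simp only [Function.uncurry_def]
      fun_prop
    · exact fun t g => (U.hasDerivAt_op_inverseOrbitJet h hξ n g t).const_smul _
    · intro t _ g hg
      simp [image_eq_zero_of_notMem_tsupport hg]

/-- Distribution vectors of `U_h` commute with smearing of smooth vectors. -/
theorem integrated_eq (hU : U.IsHaarRate μ h c) {φ : G → ℝ}
    (hφ : ContMDiff 𝓘(ℝ, E) 𝓘(ℝ, ℝ) ∞ φ) (hφc : HasCompactSupport φ)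
    (η : U.oneParamDistributionVectors h) (ξ : U.smoothVectors E) :
    U.integrated μ φ (U.distributionInclusion h η) ξ =
      η.1 ⟨U.smear μ φ ξ, U.smear_mem_oneParamSmoothVectors hU hφ hφc ξ⟩ := by
  obtain ⟨n, L, hL⟩ := U.exists_jet_functional h η
  have hL' : ∀ v, η.1 v = starRingEnd ℂ (L (U.jet h n v)) := fun v => by
    rw [← hL, Complex.conj_conj]
  let A : G → Fin (n + 1) → 𝓗 := fun g k => U.inverseOrbitJet h (ξ : 𝓗) k g
  have hA : Continuous A :=
    continuous_pi fun k => (U.contMDiff_inverseOrbitJet h ξ.2 k).continuous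
  have hint : Integrable (fun g => φ g • A g) μ :=
    (hφ.continuous.smul hA).integrable_of_hasCompactSupport hφc.smul_right
  -- The jet of the integral is the integral of the jets of U(g)⁻¹ξ, so the continuous functional L
  -- passes inside.
  have hjet : U.jet h n ⟨U.smear μ φ ξ, U.smear_mem_oneParamSmoothVectors hU hφ hφc ξ⟩ =
      ∫ g, φ g • A g ∂μ := by
    ext k
    rw [jet_apply, U.iterate_dU_smear_of_smooth μ h hφ.continuous hφc ξ.2,
      ← ContinuousLinearMap.proj_apply (R := ℝ) (φ := fun _ : Fin (n + 1) => 𝓗) k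
        (∫ g, φ g • A g ∂μ), ← ContinuousLinearMap.integral_comp_comm _ hint]
    rfl
  rw [hL', hjet, ← ContinuousLinearMap.integral_comp_comm _ hint, ← integral_conj, integrated]
  refine integral_congr_ae (Eventually.of_forall fun g => ?_)
  have h1 : (U.distributionInclusion h η).1 (U.opSmooth E g⁻¹ ξ) =
      starRingEnd ℂ (L (A g)) := by
    change η.1 _ = _
    rw [hL']
    congr 2
    ext k
    rw [jet_apply]
    exact U.iterate_dU_op_inv h ξ.2 k g
  have h2 : L (φ g • A g) = (φ g : ℂ) * L (A g) := by
    rw [← smul_eq_mul, ← L.map_smul]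
    simp
  simp [h1, h2]

end AntiunitaryRep

end Smearing

/-! ### The identity theorem on a connected analytic manifold. -/

section IdentityTheorem

/-- Identity theorem for real analytic functions on a connected manifold. -/
theorem eq_zero_of_contMDiff_omega {E : Type*} [NormedAddCommGroup E] [NormedSpace ℝ E]
    {M : Type*} [TopologicalSpace M] [ChartedSpace E M] [ConnectedSpace M]
    [IsManifold 𝓘(ℝ, E) ω M] {V : Type*} [NormedAddCommGroup V] [NormedSpace ℝ V] [CompleteSpace V]
    {f : M → V} (hf : ContMDiff 𝓘(ℝ, E) 𝓘(ℝ, V) ω f) {O : Set M} (hO : IsOpen O)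
    (hne : O.Nonempty) (hfO : ∀ x ∈ O, f x = 0) (x : M) : f x = 0 := by
  -- The set of points near which f vanishes is open. It is closed because a limit point has a chart
  -- ball meeting it, on which the identity theorem in E applies.
  let A : Set M := {x | f =ᶠ[𝓝 x] 0}
  have hAo : IsOpen A := isOpen_setOfPred_eventually_nhds
  have hAc : IsClosed A := by
    rw [← closure_subset_iff_isClosed]
    intro x hx
    let e := chartAt E x
    have hxs : x ∈ e.source := mem_chart_source E x
    obtain ⟨r, hr, hball⟩ := Metric.isOpen_iff.1 e.open_target (e x) (e.map_source hxs)
    let q : E → V := f ∘ e.symm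
    have hq : ContDiffOn ℝ ω q (Metric.ball (e x) r) := by
      rw [← contMDiffOn_iff_contDiffOn]
      exact hf.comp_contMDiffOn ((contMDiffOn_chart_symm (I := 𝓘(ℝ, E)) (n := ω)).mono hball)
    have hqa : AnalyticOnNhd ℝ q (Metric.ball (e x) r) :=
      Metric.isOpen_ball.analyticOn_iff_analyticOnNhd.1 hq.analyticOn
    have hopen : IsOpen (e.source ∩ e ⁻¹' Metric.ball (e x) r) :=
      e.isOpen_inter_preimage Metric.isOpen_ball
    obtain ⟨y, ⟨hys, hyb⟩, hyA⟩ := mem_closure_iff.1 hx _ hopen ⟨hxs, Metric.mem_ball_self hr⟩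
    have hq0 : q =ᶠ[𝓝 (e y)] 0 := by
      have h1 : Tendsto e.symm (𝓝 (e y)) (𝓝 y) := by
        have := e.continuousAt_symm (e.map_source hys)
        rwa [ContinuousAt, e.left_inv hys] at this
      exact h1.eventually hyA
    have hz := hqa.eqOn_zero_of_preconnected_of_eventuallyEq_zero
      (convex_ball (e x) r).isPreconnected hyb hq0
    filter_upwards [hopen.mem_nhds ⟨hxs, Metric.mem_ball_self hr⟩] with u hu
    have := hz hu.2
    simpa [q, e.left_inv hu.1] using this
  have hAne : A.Nonempty := by
    obtain ⟨y, hy⟩ := hne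
    exact ⟨y, by filter_upwards [hO.mem_nhds hy] with u hu using hfO u hu⟩
  have huniv := IsClopen.eq_univ ⟨hAc, hAo⟩ hAne
  have hx : x ∈ A := huniv ▸ mem_univ x
  exact hx.self_of_nhds

end IdentityTheorem

/-! ### The Reeh–Schlieder argument, isotony and covariance. -/

section ReehSchlieder

variable {E : Type*} [NormedAddCommGroup E] [NormedSpace ℝ E]
  {G : Type*} [TopologicalSpace G] [ChartedSpace E G] [Group G]
  {𝓗 : Type*} [NormedAddCommGroup 𝓗] [InnerProductSpace ℂ 𝓗]
  {τ : G ≃* G} {hτ : ∀ g : G, τ (τ g) = g}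

namespace AntiunitaryRep

variable (U : AntiunitaryRep τ hτ 𝓗)

theorem strip_eq : strip = {z : ℂ | -(Real.pi / 2) < z.im ∧ z.im < Real.pi / 2} := by
  ext z
  simp [strip, abs_lt]

theorem add_ofReal_mem_strip {z : ℂ} (hz : z ∈ strip) (s : ℝ) : z + s ∈ strip := by
  simpa [strip] using hz

variable [CompleteSpace 𝓗]

/-- The extended orbit map is equivariant under real translations. -/
theorem IsOrbitExtension.add_real {h : GroupLieAlgebra 𝓘(ℝ, E) G} {v : 𝓗} {f : ℂ → 𝓗}
    (hf : U.IsOrbitExtension h v f) (s : ℝ) :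
    EqOn (fun z => f (z + s)) (fun z => U.op (expCurve h s) (f z)) strip := by
  have hopen : IsOpen strip := by rw [strip_eq]; exact isOpen_strip _ _
  have hpre : IsPreconnected strip := by
    rw [strip_eq]
    exact ((convex_halfSpace_im_gt _).inter (convex_halfSpace_im_lt _)).isPreconnected
  have h1 : DifferentiableOn ℂ (fun z => f (z + s)) strip :=
    hf.1.comp (by fun_prop) fun z hz => add_ofReal_mem_strip hz s
  have h2 : DifferentiableOn ℂ (fun z => U.op (expCurve h s) (f z)) strip :=
    (U.op (expCurve h s)).differentiable.comp_differentiableOn hf.1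
  have h0 : (0 : ℂ) ∈ strip := by simp [strip, Real.pi_pos]
  -- Both sides are holomorphic and agree on the real axis, which accumulates at 0.
  refine (h1.analyticOnNhd hopen).eqOn_of_preconnected_of_frequently_eq
    (h2.analyticOnNhd hopen) hpre h0 ?_
  have hreal : Tendsto (fun t : ℝ => (t : ℂ)) (𝓝[≠] 0) (𝓝[≠] 0) := by
    refine tendsto_nhdsWithin_iff.2 ⟨?_, ?_⟩
    · exact (Complex.continuous_ofReal.tendsto' 0 0 (by simp)).mono_left nhdsWithin_le_nhds
    · filter_upwards [self_mem_nhdsWithin] with t ht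
      simpa using ht
  refine hreal.frequently (Eventually.of_forall fun t => ?_).frequently
  rw [← Complex.ofReal_add, hf.2, hf.2, ← op_mul, ← expCurve_add, add_comm]

variable [LieGroup 𝓘(ℝ, E) ω G]
variable [IsTopologicalGroup G] [LocallyCompactSpace G] [SecondCountableTopology G] [T2Space G]
  [MeasurableSpace G] [BorelSpace G] {μ : Measure G} [μ.IsHaarMeasure]
  {h : GroupLieAlgebra 𝓘(ℝ, E) G}

/-- The translate is supported in supp φ · exp(-sh), which stays in O for small s because supp φ is
compact. This is the room that openness of O provides. -/
theorem eventually_tsupport_subset (h : GroupLieAlgebra 𝓘(ℝ, E) G) {φ : G → ℝ}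
    (hφc : HasCompactSupport φ) {O : Set G} (hO : IsOpen O) (hφO : tsupport φ ⊆ O) :
    ∀ᶠ s in 𝓝 (0 : ℝ), ∀ a : ℝ, tsupport (fun g => a * φ (g * expCurve h s)) ⊆ O := by
  have hexp := continuous_expCurve h
  have h1 : ∀ᶠ s in 𝓝 (0 : ℝ), ∀ g ∈ tsupport φ, g * expCurve h (-s) ∈ O := by
    refine IsCompact.eventually_forall_of_forall_eventually hφc fun g hg => ?_
    have hc : Continuous fun p : ℝ × G => p.2 * expCurve h (-p.1) := by fun_prop
    exact hc.continuousAt.eventually_mem (hO.mem_nhds (by simpa [expCurve_zero] using hφO hg))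
  filter_upwards [h1] with s hs a g hg
  have hg' : g * expCurve h s ∈ tsupport φ := by
    have hcl : IsClosed {g : G | g * expCurve h s ∈ tsupport φ} :=
      (isClosed_tsupport φ).preimage (by fun_prop)
    refine closure_minimal (fun u hu => ?_) hcl hg
    exact subset_tsupport _ (right_ne_zero_of_mul hu)
  simpa [expCurve_neg] using hs _ hg'

/-- A vector orthogonal to the smeared boundary values of `v` over `O` is orthogonal to the
smeared orbit of `v` over `O`. -/
theorem inner_smear_eq_zero {c : ℝ} (hU : U.IsHaarRate μ h c) {v w : 𝓗}
    {η : U.oneParamDistributionVectors h} (hη : U.IsBetaPlus h v η) {O : Set G} (hO : IsOpen O)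
    (horth : ∀ φ : G → ℝ, ∀ (hφ : ContMDiff 𝓘(ℝ, E) 𝓘(ℝ, ℝ) ∞ φ) (hφc : HasCompactSupport φ),
      tsupport φ ⊆ O →
        η.1 ⟨U.smear μ φ w, U.smear_mem_oneParamSmoothVectors hU hφ hφc w⟩ = 0)
    {φ : G → ℝ} (hφ : ContMDiff 𝓘(ℝ, E) 𝓘(ℝ, ℝ) ∞ φ) (hφc : HasCompactSupport φ)
    (hφO : tsupport φ ⊆ O) : ⟪U.smear μ φ w, v⟫_ℂ = 0 := by
  obtain ⟨f, hf, hlim⟩ := hη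
  let p : ℂ → ℂ := fun z => ⟪U.smear μ φ w, f z⟫_ℂ
  have hp : DifferentiableOn ℂ p {z | -(Real.pi / 2) < z.im ∧ z.im < Real.pi / 2} := by
    rw [← strip_eq]
    exact (innerSL ℂ (U.smear μ φ w)).differentiable.comp_differentiableOn hf.1
  have hneg : Tendsto (fun s : ℝ => -s) (𝓝 0) (𝓝 0) := by
    simpa using (continuous_neg (G := ℝ)).tendsto 0
  obtain ⟨δ, hδ, hsub⟩ := Metric.eventually_nhds_iff.1
    (hneg.eventually (eventually_tsupport_subset h hφc hO hφO))
  have hpi := Real.pi_pos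
  have hzero := eq_zero_of_tendsto_zero_boundary (by linarith) hp (s₀ := -δ) (s₁ := δ)
    (by linarith) ?_
  · have h0 : p 0 = 0 := hzero (by simp [hpi])
    have h1 : f 0 = v := by simpa [expCurve_zero, op_one] using hf.2 0
    rw [← h1]
    exact h0
  · intro s hs
    have hsO := hsub (y := s) (by simpa [abs_lt] using hs) (Real.exp (c * -s))
    -- ψ is chosen so that smearing with it gives U_h(-s) applied to the vector smeared with φ. By
    -- equivariance of f, p(s + it) is then the pairing of that vector with f(it), whose limit is
    -- given by η and vanishes.
    let ψ : G → ℝ := fun g => Real.exp (c * -s) * φ (g * expCurve h (-s))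
    have hψ : ContMDiff 𝓘(ℝ, E) 𝓘(ℝ, ℝ) ∞ ψ :=
      contMDiff_const.mul (hφ.comp (contMDiff_mul_right (I := 𝓘(ℝ, E)) (n := ∞)))
    have hψc : HasCompactSupport ψ :=
      (hφc.comp_homeomorph (Homeomorph.mulRight (expCurve h (-s)))).mul_left
    have h1 := hlim ⟨U.smear μ ψ w, U.smear_mem_oneParamSmoothVectors hU hψ hψc w⟩
    rw [horth ψ hψ hψc hsO] at h1
    refine h1.congr' ?_
    filter_upwards [Ioo_mem_nhdsGT (show -(Real.pi / 2) < Real.pi / 2 by linarith)] with t ht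
    have hmem : (t * Complex.I : ℂ) ∈ strip := by
      rw [strip_eq]; simpa using ht
    change ⟪U.smear μ ψ w, f (t * Complex.I)⟫_ℂ = ⟪U.smear μ φ w, f (s + t * Complex.I)⟫_ℂ
    have h2 := hf.add_real U s hmem
    simp only at h2
    rw [add_comm (s : ℂ), h2, ← hU hφ.continuous hφc, U.inner_op_left, expCurve_neg, inv_inv]

/-- The fundamental lemma of the calculus of variations gives vanishing almost everywhere on O;
continuity and positivity of Haar measure on nonempty open sets remove the exceptional set. -/
theorem inner_op_eq_zero [FiniteDimensional ℝ E] {v w : 𝓗} {O : Set G} (hO : IsOpen O)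
    (horth : ∀ φ : G → ℝ, ContMDiff 𝓘(ℝ, E) 𝓘(ℝ, ℝ) ∞ φ → HasCompactSupport φ →
      tsupport φ ⊆ O → ⟪U.smear μ φ w, v⟫_ℂ = 0) {g : G} (hg : g ∈ O) : ⟪w, U.op g v⟫_ℂ = 0 := by
  have hcont : Continuous fun g : G => ⟪U.op g v, w⟫_ℂ :=
    (U.continuous_op v).inner continuous_const
  have hae := hO.ae_eq_zero_of_integral_contMDiff_smul_eq_zero (I := 𝓘(ℝ, E)) (μ := μ)
    (hcont.locallyIntegrable.locallyIntegrableOn O) fun φ hφ hφc hφO => by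
      have h1 := horth φ hφ hφc hφO
      rw [← inner_conj_symm, map_eq_zero, smear,
        ← integral_inner (U.integrable_smear μ hφ.continuous hφc w)] at h1
      rw [← h1]
      refine integral_congr_ae (Eventually.of_forall fun g => ?_)
      simp only [inner_smul_right_eq_smul, U.inner_op_left]
  have hclosed : IsClosed {g : G | ⟪U.op g v, w⟫_ℂ = 0} := isClosed_eq hcont continuous_const
  rw [inner_eq_zero_symm]
  by_contra hne
  have hopen : IsOpen (O ∩ {g : G | ⟪U.op g v, w⟫_ℂ = 0}ᶜ) := hO.inter hclosed.isOpen_compl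
  refine (hopen.measure_pos μ ⟨g, hg, hne⟩).ne' ?_
  refine measure_mono_null (fun u hu => ?_) hae
  exact fun hu' => hu.2 (hu' hu.1)

theorem isTotal_net [FiniteDimensional ℝ E] [ConnectedSpace G] (F : Submodule ℝ 𝓗)
    (hF : (F : Set 𝓗) ⊆ U.temperedVectors h ∩ U.analyticVectors E)
    (hFtotal : IsTotal {w : 𝓗 | ∃ g : G, ∃ v ∈ F, w = U.op g v})
    {O : Set G} (hO : IsOpen O) (hne : O.Nonempty) :
    IsTotal (U.net μ (U.betaPlusImage h F) O : Set 𝓗) := by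
  obtain ⟨c, hU⟩ := U.exists_isHaarRate μ h
  rw [IsTotal, Submodule.dense_iff_topologicalClosure_eq_top,
    Submodule.topologicalClosure_eq_top_iff, Submodule.eq_bot_iff]
  rw [IsTotal, Submodule.dense_iff_topologicalClosure_eq_top,
    Submodule.topologicalClosure_eq_top_iff] at hFtotal
  intro w hw
  have hw' : ∀ u ∈ U.netGenerators μ (U.betaPlusImage h F) O, ⟪w, u⟫_ℂ = 0 := by
    intro u hu
    rw [inner_eq_zero_symm]
    exact (Submodule.mem_orthogonal _ _).1 hw u (Submodule.subset_span
      (Submodule.le_topologicalClosure _ (Submodule.subset_span hu)))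
  rw [← Submodule.mem_bot ℂ, ← hFtotal, Submodule.mem_orthogonal]
  intro u hu
  induction hu using Submodule.span_induction with
  | zero => simp
  | add x y _ _ hx hy => rw [inner_add_left, hx, hy, add_zero]
  | smul a x _ hx => rw [inner_smul_left, hx, mul_zero]
  | mem x hx =>
    obtain ⟨g, v, hv, rfl⟩ := hx
    obtain ⟨⟨-, -, hβ, -⟩, hω⟩ := hF hv
    have hη : U.IsBetaPlus h v (U.betaPlus h v) := by
      rw [betaPlus, dif_pos hβ]
      exact hβ.choose_spec
    have hω' : ContMDiff 𝓘(ℝ, E) 𝓘(ℝ, 𝓗) ω fun g : G => U.op g v := hω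
    have hin : ContMDiff 𝓘(ℝ, E) 𝓘(ℝ, ℂ) ω fun g : G => ⟪w, U.op g v⟫_ℂ :=
      ((innerSL ℂ w).restrictScalars ℝ).contMDiff.comp hω'
    rw [inner_eq_zero_symm]
    refine eq_zero_of_contMDiff_omega hin hO hne (fun g hg => ?_) g
    refine U.inner_op_eq_zero (E := E) (μ := μ) hO (fun φ hφ hφc hφO => ?_) hg
    refine U.inner_smear_eq_zero hU hη hO (fun ψ hψ hψc hψO => ?_) hφ hφc hφO
    -- The Riesz vector u is a generator of the net, so w ⊥ u. Its defining formula holds for all of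
    -- 𝓗, hence may be evaluated at w itself, which need not be smooth.
    obtain ⟨u, hu⟩ := U.exists_smeared_vector hU hψ hψc (U.betaPlus h v)
    rw [← hu w]
    refine hw' u ⟨ψ, hψ, hψc, hψO, _, ⟨v, hv, rfl⟩, fun ξ => ?_⟩
    rw [hu, U.integrated_eq hU hψ hψc]

theorem isotone_net (D : Set (U.distributionVectors E)) : Isotone (U.net μ D) := by
  intro O₁ O₂ _ _ hO
  refine Submodule.topologicalClosure_mono (Submodule.span_mono ?_)
  rintro w ⟨φ, hφ, hφc, hφO, hw⟩
  exact ⟨φ, hφ, hφc, hφO.trans hO, hw⟩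

theorem integrated_translate (φ : G → ℝ) (η : U.distributionVectors E) (g : G)
    (ξ : U.smoothVectors E) :
    U.integrated μ (fun x => φ (g⁻¹ * x)) η ξ = U.integrated μ φ η (U.opSmooth E g⁻¹ ξ) := by
  rw [integrated, ← integral_mul_left_eq_self _ g, integrated]
  refine integral_congr_ae (Eventually.of_forall fun x => ?_)
  have : U.opSmooth E (g * x)⁻¹ ξ = U.opSmooth E x⁻¹ (U.opSmooth E g⁻¹ ξ) := by
    refine Subtype.ext ?_
    change U.op (g * x)⁻¹ ξ = U.op x⁻¹ (U.op g⁻¹ ξ)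
    rw [mul_inv_rev, op_mul]
  simp only [inv_mul_cancel_left, this]

/-- By left invariance of Haar measure, U(g) maps the generator for φ to the one for the left
translate φ(g⁻¹ ·), supported in gO. Linearity and continuity extend this to the closed span. -/
theorem op_mem_net {D : Set (U.distributionVectors E)} (g : G) {O : Set G} {v : 𝓗}
    (hv : v ∈ U.net μ D O) : U.op g v ∈ U.net μ D ((fun x => g * x) '' O) := by
  refine map_mem_closure (U.op g).continuous hv fun u hu => ?_
  let T : 𝓗 →ₗ[ℝ] 𝓗 := (U.op g).toLinearMap.restrictScalars ℝ
  suffices hle : Submodule.span ℝ (U.netGenerators μ D O) ≤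
      (Submodule.span ℝ (U.netGenerators μ D ((fun x => g * x) '' O))).comap T from hle hu
  refine Submodule.span_le.2 ?_
  rintro w ⟨φ, hφ, hφc, hφO, η, hη, hw⟩
  refine Submodule.subset_span ⟨fun x => φ (g⁻¹ * x),
    hφ.comp (contMDiff_mul_left (I := 𝓘(ℝ, E)) (n := ∞)),
    hφc.comp_homeomorph (Homeomorph.mulLeft g⁻¹), ?_, η, hη, fun ξ => ?_⟩
  · have h1 : tsupport (fun x => φ (g⁻¹ * x)) ⊆ (fun x => g⁻¹ * x) ⁻¹' tsupport φ :=
      closure_minimal (fun x hx => subset_tsupport _ hx)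
        ((isClosed_tsupport φ).preimage (by fun_prop))
    exact fun x hx => ⟨g⁻¹ * x, hφO (h1 hx), by simp⟩
  · rw [U.integrated_translate, ← hw]
    change ⟪(ξ : 𝓗), U.op g w⟫_ℂ = ⟪U.op g⁻¹ ξ, w⟫_ℂ
    rw [U.inner_op_left, inv_inv]

theorem covariant_net (D : Set (U.distributionVectors E)) : Covariant U (U.net μ D) := by
  intro g O _
  refine Subset.antisymm ?_ fun v hv => ⟨U.op g⁻¹ v, ?_, U.op_op_inv g v⟩
  · rintro _ ⟨v, hv, rfl⟩
    exact U.op_mem_net g hv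
  · have h1 := U.op_mem_net g⁻¹ hv
    have h2 : (fun x => g⁻¹ * x) '' ((fun x => g * x) '' O) = O := by
      rw [image_image]
      simp
    rwa [h2] at h1

end AntiunitaryRep

/-- The complex span of a real subspace is contained in V + iV, since (a + ib)(v + iw) = (av - bw) +
i(bv + aw). -/
theorem IsTotal.isCyclic {V : Submodule ℝ 𝓗} (hV : IsTotal (V : Set 𝓗)) : IsCyclic V := by
  refine Dense.mono (fun z hz => ?_) hV
  rw [SetLike.mem_coe] at hz
  induction hz using Submodule.span_induction with
  | zero => exact ⟨0, V.zero_mem, 0, V.zero_mem, by simp⟩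
  | mem x hx => exact ⟨x, hx, 0, V.zero_mem, by simp⟩
  | add x y _ _ hx hy =>
    obtain ⟨v, hv, w, hw, rfl⟩ := hx
    obtain ⟨v', hv', w', hw', rfl⟩ := hy
    exact ⟨v + v', V.add_mem hv hv', w + w', V.add_mem hw hw', by rw [smul_add]; abel⟩
  | smul a x _ hx =>
    obtain ⟨v, hv, w, hw, rfl⟩ := hx
    refine ⟨a.re • v - a.im • w, V.sub_mem (V.smul_mem _ hv) (V.smul_mem _ hw),
      a.im • v + a.re • w, V.add_mem (V.smul_mem _ hv) (V.smul_mem _ hw), ?_⟩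
    have h1 : a • v = a.re • v + Complex.I • a.im • v := by
      nth_rewrite 1 [← Complex.re_add_im a]
      rw [add_smul, Complex.coe_smul, mul_comm, mul_smul, Complex.coe_smul]
    have h2 : a • Complex.I • w = Complex.I • a.re • w - a.im • w := by
      have hI : a * Complex.I = Complex.I * (a.re : ℂ) - (a.im : ℂ) := by
        apply Complex.ext <;> simp
      rw [smul_smul, hI, sub_smul, mul_smul, Complex.coe_smul, Complex.coe_smul]
    rw [smul_add, h1, h2, smul_add]
    abel

end ReehSchlieder

end LieNet

end

theorem mainTheorem6
    {E : Type*} [NormedAddCommGroup E] [NormedSpace ℝ E] [FiniteDimensional ℝ E]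
    {G : Type*} [TopologicalSpace G] [T2Space G] [ConnectedSpace G] [ChartedSpace E G] [Group G]
    [LieGroup 𝓘(ℝ, E) ω G] [MeasurableSpace G] [BorelSpace G]
    (μ : MeasureTheory.Measure G) [μ.IsHaarMeasure]
    (h : GroupLieAlgebra 𝓘(ℝ, E) G) (hh : LieNet.IsEulerElement h)
    (τ : G ≃* G) (hτ : LieNet.IsEulerInvolution h τ)
    {𝓗 : Type*} [NormedAddCommGroup 𝓗] [InnerProductSpace ℂ 𝓗] [CompleteSpace 𝓗]
    (U : LieNet.AntiunitaryRep τ hτ.involutive 𝓗)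
    (F : Submodule ℝ 𝓗)
    (hF : (F : Set 𝓗) ⊆ U.temperedVectors h ∩ U.analyticVectors E)
    (hFtotal : LieNet.IsTotal {w : 𝓗 | ∃ g : G, ∃ v ∈ F, w = U.op g v}) :
    (∀ O : Set G, IsOpen O → O.Nonempty →
      LieNet.IsTotal (U.net μ (U.betaPlusImage h F) O : Set 𝓗)) ∧
    LieNet.Isotone (U.net μ (U.betaPlusImage h F)) ∧
    LieNet.Covariant U (U.net μ (U.betaPlusImage h F)) ∧
    LieNet.ReehSchlieder (U.net μ (U.betaPlusImage h F)) := by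
  have : LocallyCompactSpace G := Manifold.locallyCompact_of_finiteDimensional 𝓘(ℝ, E)
  have : IsTopologicalGroup G := topologicalGroup_of_lieGroup 𝓘(ℝ, E) ω
  -- Connectedness yields σ-compactness and with it second countability, on which the Haar
  -- integration rests.
  have : SigmaCompactSpace G := LieNet.sigmaCompactSpace_of_connected G
  have : ProperSpace E := FiniteDimensional.proper ℝ E
  have : SecondCountableTopology G := ChartedSpace.secondCountable_of_sigmaCompact E G
  refine ⟨fun O hO hne => U.isTotal_net F hF hFtotal hO hne, U.isotone_net _, U.covariant_net _,
    fun O hO hne => (U.isTotal_net F hF hFtotal hO hne).isCyclic⟩
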